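/- Let $F$ be a field of characteristic zero, $d\in F$ a non-square, $K=F(\sqrt d)$, and $z\mapsto\overline z$ the nontrivial automorphism of $K/F$, applied entrywise to matrices and extended additively to tensors by $\overline{A\otimes B}=\overline A\otimes\overline B$; put $X^*=\overline X^{T}$. Let $n$ be a natural number and $\mathfrak g=\mathfrak{su}(n,F,d)=\{A\in\mathfrak{sl}(n,K): A^*+A=0\}$, an $F$-Lie algebra. For $X\in\mathrm{GL}(n,K)$ let $\mathrm{Ad}_X(A)=XAX^{-1}$, and for $r\in\mathfrak{gl}(n,K)\otimes_K\mathfrak{gl}(n,K)$ let $\partial r(a)=[r,a\otimes1+1\otimes a]$ and $C(r)=\{M\in\mathrm{GL}(n,K):(\mathrm{Ad}_M\otimes\mathrm{Ad}_M)(r)=r\}$. We say that $\partial r$ defines a Lie bialgebra structure on $\mathfrak g$ if there is a Lie bialgebra structure $\delta:\mathfrak g\to\mathfrak g\otimes_F\mathfrak g$ (the transpose of $\delta$ is a Lie bracket on $\mathfrak g^*$, and $\delta([a,b])=a\cdot\delta(b)-b\cdot\delta(a)$ for all $a,b\in\mathfrak g$, where $a\cdot t=(\mathrm{ad}_a\otimes1+1\otimes\mathrm{ad}_a)(t)$)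 whose composite with the natural map $\mathfrak g\otimes_F\mathfrak g\to\mathfrak{gl}(n,K)\otimes_K\mathfrak{gl}(n,K)$ is the restriction of $\partial r$ to $\mathfrak g$. Let $\mathfrak h$ be the space of trace zero diagonal matrices in $\mathfrak{sl}(n,K)$, $\Gamma=\{\alpha_1,\dots,\alpha_{n-1}\}$ the simple roots, where $\alpha_i(A)=A_{ii}-A_{i+1,i+1}$, and $\Delta^+$ the corresponding positive roots. Fix root vectors: for each root $\alpha$ a nonzero multiple $e_\alpha$ of the matrix unit $E_{ij}$ spanning the root space, with $\mathrm{tr}(e_\alpha e_{-\alpha})=1$ and $e_{\alpha_i}=E_{i,i+1}$ for the simple roots. Let $\Omega_0=\sum_iE_{ii}\otimes E_{ii}-\frac1n\,1\otimes1$ be the Cartan part of the Casimir element for the trace form. An admissible triple $(\Gamma_1,\Gamma_2,\tau)$ consists of $\Gamma_1,\Gamma_2\subseteq\Gamma$ and an isometric bijection $\tau:\Gamma_1\to\Gamma_2$ such that for each $\alpha\in\Gamma_1$ there is $k$ with $\tau^k(\alpha)\notin\Gamma_1$; $\tau$ is extended additively to $\mathrm{Span}(\Gamma_1)^+$. A Belavin–Drinfeld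 $r$-matrix over $K$ with this triple is a solution $r_{BD}=r_0+r_1$ of the classical Yang–Baxter equation $[r_{12},r_{13}]+[r_{12},r_{23}]+[r_{13},r_{23}]=0$ such that $r_0\in\mathfrak h\otimes\mathfrak h$, $r_0+r_0^{21}=\Omega_0$, $(\tau(\alpha)\otimes\mathrm{Id}+\mathrm{Id}\otimes\alpha)(r_0)=0$ for all $\alpha\in\Gamma_1$, and $$r_1=\sum_{\alpha\in\Delta^+}e_\alpha\otimes e_{-\alpha}+\sum_{\alpha\in\mathrm{Span}(\Gamma_1)^+}\ \sum_{k\ge1}e_\alpha\wedge e_{-\tau^k(\alpha)},$$ where $a\wedge b=a\otimes b-b\otimes a$ and the inner sum is over those $k$ for which $\tau^k(\alpha)$ is defined. Let $S\in\mathrm{GL}(n,K)$ be the antidiagonal matrix $S_{ij}=\delta_{i,n+1-j}$ and $s:\Gamma\to\Gamma$, $s(\alpha_i)=\alpha_{n-i}$. **Proposition.** Let $r_{BD}=r_0+r_1$ be a Belavin–Drinfeld $r$-matrix over $K$ with admissible triple $(\Gamma_1,\Gamma_2,\tau)$, let $X\in\mathrm{GL}(n,K)$, and let $r=(\mathrm{Ad}_X\otimes\mathrm{Ad}_X)(r_{BD})$.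 Then $\partial r$ defines a Lie bialgebra structure on $\mathfrak g$ if and only if the following three conditions hold: 1. $X^*X=SD$ for some $D\in C(r_{BD})$; 2. $\overline{r_0}=(\mathrm{Ad}_S\otimes\mathrm{Ad}_S)(r_0)$; 3. $s(\Gamma_i)=\Gamma_i$ for $i\in\{1,2\}$, and $s\tau=\tau s$ on $\Gamma_1$. -/

import Mathlib

open scoped TensorProduct Matrix

noncomputable section

namespace LieBialg

/-! ### Lie bialgebra structures -/

section Bialgebra

variable {F : Type*} [Field F] {L : Type*} [LieRing L] [LieAlgebra F L]

/-- The bilinear operation on `L*` obtained as the transpose of `δ : L → L ⊗ L`: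
`[φ, ψ] = (φ ⊗ ψ) ∘ δ`. -/
def dualBracket (δ : L →ₗ[F] L ⊗[F] L) (φ ψ : Module.Dual F L) : Module.Dual F L :=
  TensorProduct.dualDistrib F L L (φ ⊗ₜ[F] ψ) ∘ₗ δ

/-- The operator `ad_a ⊗ 1 + 1 ⊗ ad_a` on `L ⊗ L`. -/
def adTensor (a : L) : L ⊗[F] L →ₗ[F] L ⊗[F] L :=
  TensorProduct.map (LieAlgebra.ad F L a) LinearMap.id +
    TensorProduct.map LinearMap.id (LieAlgebra.ad F L a)

/-- `δ` is a Lie bialgebra structure on the Lie algebra `L`: its transpose is a Lie bracket on the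
dual space, and `δ` satisfies the cocycle condition. -/
structure IsLieBialgebraStructure (δ : L →ₗ[F] L ⊗[F] L) : Prop where
  alternating : ∀ φ, dualBracket δ φ φ = 0
  jacobi : ∀ φ ψ χ,
    dualBracket δ φ (dualBracket δ ψ χ) + dualBracket δ ψ (dualBracket δ χ φ) +
      dualBracket δ χ (dualBracket δ φ ψ) = 0
  cocycle : ∀ a b : L, δ ⁅a, b⁆ = adTensor a (δ b) - adTensor b (δ a)

end Bialgebra

/-! ### Tensors over associative algebras and matrix algebras -/

section YangBaxter

variable (K : Type*) [Field K] (A : Type*) [Ring A] [Algebra K A]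

/-- `a ⊗ b ↦ a ⊗ b ⊗ 1`. -/
def leg₁₂ : A ⊗[K] A →ₐ[K] A ⊗[K] (A ⊗[K] A) :=
  Algebra.TensorProduct.map (AlgHom.id K A) Algebra.TensorProduct.includeLeft

/-- `a ⊗ b ↦ a ⊗ 1 ⊗ b`. -/
def leg₁₃ : A ⊗[K] A →ₐ[K] A ⊗[K] (A ⊗[K] A) :=
  Algebra.TensorProduct.map (AlgHom.id K A) Algebra.TensorProduct.includeRight

/-- `a ⊗ b ↦ 1 ⊗ a ⊗ b`. -/
def leg₂₃ : A ⊗[K] A →ₐ[K] A ⊗[K] (A ⊗[K] A) :=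
  Algebra.TensorProduct.includeRight

variable {K A}

/-- The classical Yang–Baxter operator
`CYB(r) = [r₁₂, r₁₃] + [r₁₂, r₂₃] + [r₁₃, r₂₃]`. -/
def CYB (r : A ⊗[K] A) : A ⊗[K] (A ⊗[K] A) :=
  (leg₁₂ K A r * leg₁₃ K A r - leg₁₃ K A r * leg₁₂ K A r) +
    (leg₁₂ K A r * leg₂₃ K A r - leg₂₃ K A r * leg₁₂ K A r) +
    (leg₁₃ K A r * leg₂₃ K A r - leg₂₃ K A r * leg₁₃ K A r)

end YangBaxter

/-- The matrix algebra `gl(n, K)`. -/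
abbrev Mat (n : ℕ) (K : Type*) : Type _ := Matrix (Fin n) (Fin n) K

section Tensors

variable {n : ℕ} {K : Type*} [Field K]

/-- The matrix unit `E_{ij}`. -/
def E (i j : Fin n) : Mat n K := Matrix.single i j 1

/-- `Ad_X : A ↦ X A X⁻¹`. -/
def Ad (X : GL (Fin n) K) : Mat n K →ₗ[K] Mat n K :=
  LinearMap.mulLeft K (X : Mat n K) ∘ₗ LinearMap.mulRight K ((X⁻¹ : GL (Fin n) K) : Mat n K)

/-- `Ad_X ⊗ Ad_X`. -/
def Ad₂ (X : GL (Fin n) K) : Mat n K ⊗[K] Mat n K →ₗ[K] Mat n K ⊗[K] Mat n K :=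
  TensorProduct.map (Ad X) (Ad X)

/-- The centralizer `C(r)` of a tensor `r`. -/
def centralizer (r : Mat n K ⊗[K] Mat n K) : Set (GL (Fin n) K) := {M | Ad₂ M r = r}

/-- The flip `r ↦ r²¹`. -/
def flipTensor (r : Mat n K ⊗[K] Mat n K) : Mat n K ⊗[K] Mat n K :=
  TensorProduct.comm K (Mat n K) (Mat n K) r

/-- `∂r (a) = [r, a ⊗ 1 + 1 ⊗ a]`. -/
def coboundary (r : Mat n K ⊗[K] Mat n K) (a : Mat n K) : Mat n K ⊗[K] Mat n K :=
  r * (a ⊗ₜ[K] 1 + 1 ⊗ₜ[K] a) - (a ⊗ₜ[K] 1 + 1 ⊗ₜ[K] a) * r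

/-- The Cartan subalgebra of trace zero diagonal matrices. -/
def cartan (n : ℕ) (K : Type*) [Field K] : Submodule K (Mat n K) where
  carrier := {A | A.IsDiag ∧ A.trace = 0}
  add_mem' := fun ha hb => ⟨ha.1.add hb.1, by rw [Matrix.trace_add, ha.2, hb.2, add_zero]⟩
  zero_mem' := ⟨Matrix.isDiag_zero, Matrix.trace_zero _ _⟩
  smul_mem' := fun c _ ha => ⟨ha.1.smul c, by rw [Matrix.trace_smul, ha.2, smul_zero]⟩

/-- `𝔥 ⊗ 𝔥`, as a subspace of `gl(n, K) ⊗ gl(n, K)`. -/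
def cartan₂ (n : ℕ) (K : Type*) [Field K] : Submodule K (Mat n K ⊗[K] Mat n K) :=
  LinearMap.range (TensorProduct.mapIncl (cartan n K) (cartan n K))

/-- The `𝔥`-component `Ω₀` of the Casimir element of `sl(n, K)` for the trace form. -/
def casimirCartan (n : ℕ) (K : Type*) [Field K] : Mat n K ⊗[K] Mat n K :=
  ∑ i : Fin n, E i i ⊗ₜ[K] E i i - (n : K)⁻¹ • ((1 : Mat n K) ⊗ₜ[K] (1 : Mat n K))

end Tensors

/-! ### Roots of `sl(n)`

The simple roots `α₁, …, α_{n-1}` are indexed by `Fin (n - 1)`; the index `a` stands for the root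
of `E_{a,a+1}` (indices starting from `0`). -/

/-- The row index of the simple root vector `E_{a,a+1}`. -/
def lo {n : ℕ} (a : Fin (n - 1)) : Fin n := ⟨a.val, by have := a.isLt; omega⟩

/-- The column index of the simple root vector `E_{a,a+1}`. -/
def hi {n : ℕ} (a : Fin (n - 1)) : Fin n := ⟨a.val + 1, by have := a.isLt; omega⟩

/-- The inner product of two simple roots. -/
def rootForm {m : ℕ} (a b : Fin m) : ℤ :=
  if a = b then 2 else if a.val + 1 = b.val ∨ b.val + 1 = a.val then -1 else 0

/-- The simple root `α_a`, as the linear functional `A ↦ A_{a,a} - A_{a+1,a+1}`. -/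
def simpleRoot {n : ℕ} (K : Type*) [Field K] (a : Fin (n - 1)) : Mat n K →ₗ[K] K :=
  Matrix.entryLinearMap K K (lo a) (lo a) - Matrix.entryLinearMap K K (hi a) (hi a)

/-- The set of positive roots: the pair `(i, j)` with `i < j` is the root of `E_{ij}`. -/
def posRoots (n : ℕ) : Finset (Fin n × Fin n) := Finset.univ.filter fun α => α.1 < α.2

/-- The simple roots whose sum is the positive root `(i, j)`. -/
def supp {n : ℕ} (α : Fin n × Fin n) : Finset (Fin (n - 1)) :=
  Finset.univ.filter fun a => α.1.val ≤ a.val ∧ a.val < α.2.val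

/-- Admissible triples `(Γ₁, Γ₂, τ)` for `sl(n)`. The values of `τ` outside `Γ₁` are
irrelevant. -/
structure AdmissibleTriple (n : ℕ) where
  Γ₁ : Finset (Fin (n - 1))
  Γ₂ : Finset (Fin (n - 1))
  τ : Fin (n - 1) → Fin (n - 1)
  bijOn : Set.BijOn τ Γ₁ Γ₂
  isometric : ∀ a ∈ Γ₁, ∀ b ∈ Γ₁, rootForm (τ a) (τ b) = rootForm a b
  nilpotent : ∀ a ∈ Γ₁, ∃ k : ℕ, τ^[k] a ∉ Γ₁

/-- `τᵏ(α)` is defined and equal to `β`, for positive roots `α` and `β` and the additive extension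
of `τ` to sums of elements of `Γ₁`: the simple roots in `α`, and their images under
`τ, …, τᵏ⁻¹`, belong to `Γ₁`, and those of `β` are the images under `τᵏ`. For `k ≥ 1` this
includes `α ∈ Span(Γ₁)⁺`. -/
def AdmissibleTriple.PowEq {n : ℕ} (T : AdmissibleTriple n) (k : ℕ) (α β : Fin n × Fin n) : Prop :=
  (∀ m < k, (supp α).image T.τ^[m] ⊆ T.Γ₁) ∧ (supp α).image T.τ^[k] = supp β

/-- A choice of root vectors `e_{ij} = c_{ij} E_{ij}` in the root spaces of `sl(n, K)` which are
dual for the trace form, `tr (e_α e_{-α}) = 1`, and are `E_{a,a+1}` for simple roots (hence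
`E_{a+1,a}` for their negatives). -/
structure RootVectors (n : ℕ) (K : Type*) [Field K] where
  coeff : Fin n → Fin n → K
  dual : ∀ i j, i ≠ j → coeff i j * coeff j i = 1
  simple : ∀ a : Fin (n - 1), coeff (lo a) (hi a) = 1

section BelavinDrinfeld

variable {n : ℕ} {K : Type*} [Field K]

/-- The root vector `e_α` for `α = (i, j)`. -/
def RootVectors.pos (e : RootVectors n K) (α : Fin n × Fin n) : Mat n K :=
  e.coeff α.1 α.2 • E α.1 α.2

/-- The root vector `e_{-α}` for `α = (i, j)`. -/
def RootVectors.neg (e : RootVectors n K) (α : Fin n × Fin n) : Mat n K :=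
  e.coeff α.2 α.1 • E α.2 α.1

open Classical in
/-- `r₁ = ∑_{α > 0} e_α ⊗ e_{-α} + ∑_{α ∈ Span(Γ₁)⁺} ∑_{k ≥ 1} e_α ∧ e_{-τᵏ(α)}`, where
`a ∧ b = a ⊗ b - b ⊗ a` and the inner sum runs over the `k` for which `τᵏ(α)` is defined
(so that `k < n`). -/
def rOne (T : AdmissibleTriple n) (e : RootVectors n K) : Mat n K ⊗[K] Mat n K :=
  ∑ α ∈ posRoots n, e.pos α ⊗ₜ[K] e.neg α +
    ∑ α ∈ posRoots n, ∑ k ∈ Finset.Ico 1 n, ∑ β ∈ posRoots n with T.PowEq k α β,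
      (e.pos α ⊗ₜ[K] e.neg β - e.neg β ⊗ₜ[K] e.pos α)

/-- `r₀ + r₁` is a Belavin–Drinfeld `r`-matrix over `K` with admissible triple `T`. -/
structure IsBelavinDrinfeld (T : AdmissibleTriple n) (e : RootVectors n K)
    (r₀ : Mat n K ⊗[K] Mat n K) : Prop where
  mem_cartan : r₀ ∈ cartan₂ n K
  add_flip : r₀ + flipTensor r₀ = casimirCartan n K
  /-- `(τ(α) ⊗ Id + Id ⊗ α)(r₀) = 0` for `α ∈ Γ₁`. -/
  compat : ∀ a ∈ T.Γ₁,
    TensorProduct.lid K (Mat n K) ((simpleRoot K (T.τ a)).rTensor (Mat n K) r₀) +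
      TensorProduct.rid K (Mat n K) ((simpleRoot K a).lTensor (Mat n K) r₀) = 0
  cyb : CYB (r₀ + rOne T e) = 0

end BelavinDrinfeld

/-! ### The Lie algebra `su(n, F, d)` -/

section Unitary

attribute [local instance] LieRing.ofAssociativeRing

variable {F K : Type*} [Field F] [Field K] [Algebra F K]

/-- The entrywise conjugate `A ↦ Ā`, for the automorphism `σ` of `K`. -/
def conjMat (σ : K ≃ₐ[F] K) (n : ℕ) : Mat n K →ₛₗ[(σ : K →+* K)] Mat n K where
  toFun A := A.map σ
  map_add' A B := by ext; simp
  map_smul' c A := by ext; simp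

/-- `a ⊗ b ↦ ā ⊗ b̄`, extended additively. -/
def conj₂ (σ : K ≃ₐ[F] K) (n : ℕ) :
    Mat n K ⊗[K] Mat n K →ₛₗ[(σ : K →+* K)] Mat n K ⊗[K] Mat n K :=
  TensorProduct.map (conjMat σ n) (conjMat σ n)

/-- `X* = X̄ᵀ`. -/
def starMat (σ : K ≃ₐ[F] K) {n : ℕ} (A : Mat n K) : Mat n K := (A.map σ)ᵀ

/-- The `F`-Lie algebra `su(n, F, d)` of trace zero matrices `A` over `K = F(√d)` with
`Āᵀ + A = 0`, where `σ` is the conjugation of `K` over `F`. -/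
def su (σ : K ≃ₐ[F] K) (n : ℕ) : LieSubalgebra F (Mat n K) where
  carrier := {A | A.trace = 0 ∧ starMat σ A + A = 0}
  add_mem' := by
    rintro A B ⟨hA, hA'⟩ ⟨hB, hB'⟩
    refine ⟨by rw [Matrix.trace_add, hA, hB, add_zero], ?_⟩
    have : starMat σ (A + B) = starMat σ A + starMat σ B := by ext; simp [starMat]
    rw [this, add_add_add_comm, hA', hB', add_zero]
  zero_mem' := ⟨Matrix.trace_zero _ _, by ext; simp [starMat]⟩
  smul_mem' := by
    rintro c A ⟨hA, hA'⟩
    refine ⟨by rw [Matrix.trace_smul, hA, smul_zero], ?_⟩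
    have : starMat σ (c • A) = c • starMat σ A := by ext; simp [starMat]
    rw [this, ← smul_add, hA', smul_zero]
  lie_mem' := by
    rintro A B ⟨-, hA⟩ ⟨-, hB⟩
    refine ⟨Matrix.trace_sub _ _ |>.trans (by rw [Matrix.trace_mul_comm, sub_self]), ?_⟩
    have h : ∀ P Q : Mat n K, starMat σ (P * Q) = starMat σ Q * starMat σ P := by
      intro P Q
      have := Matrix.map_mul (L := P) (M := Q) (f := (σ : K →+* K))
      simp only [starMat, ← Matrix.transpose_mul]
      exact congrArg Matrix.transpose this
    have h' : ∀ P Q : Mat n K, starMat σ (P - Q) = starMat σ P - starMat σ Q := by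
      intro P Q; ext; simp [starMat]
    rw [Ring.lie_def, h', h, h, eq_neg_of_add_eq_zero_left hA, eq_neg_of_add_eq_zero_left hB]
    noncomm_ring

/-- The natural map `𝔤 ⊗_F 𝔤 → gl(n, K) ⊗_K gl(n, K)` for `𝔤 = su(n, F, d)`, `a ⊗ b ↦ a ⊗ b`. -/
def suIncl₂ (σ : K ≃ₐ[F] K) (n : ℕ) :
    (su σ n) ⊗[F] (su σ n) →ₗ[F] Mat n K ⊗[K] Mat n K :=
  TensorProduct.lift
    (((TensorProduct.mk K (Mat n K) (Mat n K)).restrictScalars₁₂ F F).compl₁₂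
      (su σ n).toSubmodule.subtype (su σ n).toSubmodule.subtype)

/-- `∂r` defines a Lie bialgebra structure on `𝔤 = su(n, F, d)`: the restriction of `∂r` to `𝔤` is
a Lie bialgebra structure `𝔤 → 𝔤 ⊗_F 𝔤`. -/
def DefinesLieBialgebra (σ : K ≃ₐ[F] K) {n : ℕ} (r : Mat n K ⊗[K] Mat n K) : Prop :=
  ∃ δ : su σ n →ₗ[F] su σ n ⊗[F] su σ n,
    IsLieBialgebraStructure δ ∧ ∀ a, suIncl₂ σ n (δ a) = coboundary r (a : Mat n K)

end Unitary

/-- The permutation matrix of the order reversal, i.e. the anti-diagonal matrix `S` with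
`S_{ij} = δ_{i,n+1-j}`. -/
def S (n : ℕ) (K : Type*) [Field K] : GL (Fin n) K where
  val := Matrix.of fun i j => if i = Fin.rev j then 1 else 0
  inv := Matrix.of fun i j => if i = Fin.rev j then 1 else 0
  val_inv := by ext i j; simp [Matrix.mul_apply, Matrix.one_apply]
  inv_val := by ext i j; simp [Matrix.mul_apply, Matrix.one_apply]

end LieBialg

end

/-! Through the trace form, a tensor r becomes an operator f on gl(n, K) (`contract`), and every
condition becomes one on f. Conjugating r by Ad_X ⊗ Ad_X conjugates f by Ad_X; ∂r(a) is the failure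
of f to commute with ad a; r + r²¹ = Ω says that f plus its transpose is the projection onto sl(n);
and given this, the Yang–Baxter equation yields [f x, f y] = f([x, y]_f) with [x, y]_f = [f x, y] +
[x, f y] - [x, y].

Descent. The tensor star a ⊗ b ↦ a* ⊗ b* is the conjugation of sl(n) ⊗ sl(n) whose fixed points are
su(n) ⊗ su(n). If ∂r maps su(n) there, then r and its star have the same coboundary and the same
symmetric part, so their difference is an invariant antisymmetric operator, which is zero.
Conversely, a fixed r has a coboundary that descends, and the dual bracket is [ , ]_f, a Lie bracket
by Yang–Baxter. This is `definesLieBialgebra_iff`.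

Gauge. For r = Ad_X(r_BD), being fixed means that r' = Ad_Z(r_BD), where Z = S X* X and r' is the
star of r_BD conjugated by S (`revConj`). Star exchanges upper and lower triangular matrices and S
exchanges them back, so the operator of r' is again triangular. Since S² = 1, condition 1 says
exactly that Z centralizes r_BD.

Rigidity. Operators of this kind are nilpotent on strictly lower and unipotent on strictly upper
triangular matrices, so an intertwining Z must be diagonal (`isDiag_of_intertwine`). Such a Z is
invisible on the Cartan part, which gives condition 2, and rescales simple root vectors, so the
relation "b = τᵏ(a) for some k ≥ 1" is invariant under s; τ is recovered from it as its covering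
relation, which gives condition 3. Conversely, conditions 2 and 3 make the operators of r' and r_BD
agree on diagonal matrices and simple root vectors, and Yang–Baxter propagates the equality
everywhere (`eq_of_eq_simple`). Hence r' = r_BD, and the gauge equation reduces to condition 1. -/

namespace LieBialg

/-! ### Tensors as operators, and the Yang–Baxter equation in operator form -/

section Contract

variable {n : ℕ} {K : Type*} [Field K]

/-- The functional `y ↦ tr (y a)`. -/
noncomputable def trMul (a : Mat n K) : Mat n K →ₗ[K] K :=
  Matrix.traceLinearMap (Fin n) K K ∘ₗ LinearMap.mulRight K a

@[simp] theorem trMul_apply (a y : Mat n K) : trMul a y = (y * a).trace := rfl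

/-- A tensor as an operator: `x ⊗ y` acts by `a ↦ tr (y a) x`. -/
noncomputable def contract : Mat n K ⊗[K] Mat n K →ₗ[K] Mat n K →ₗ[K] Mat n K :=
  TensorProduct.lift (LinearMap.mk₂ K
    (fun x y => (Matrix.traceLinearMap (Fin n) K K ∘ₗ LinearMap.mulLeft K y).smulRight x)
    (fun x x' y => by ext1 a; simp)
    (fun c x y => by
      ext1 a
      simp only [LinearMap.smulRight_apply, LinearMap.smul_apply]
      exact smul_comm _ _ _)
    (fun x y y' => by ext1 a; simp [add_mul, add_smul])
    (fun c x y => by ext1 a; simp [mul_smul]))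

@[simp] theorem contract_tmul (x y a : Mat n K) :
    contract (x ⊗ₜ[K] y) a = (y * a).trace • x := rfl

theorem trace_E_mul (k l : Fin n) (a : Mat n K) : (E k l * a).trace = a l k := by
  simp [E, Matrix.trace_single_mul]

theorem trace_mul_E (k l : Fin n) (a : Mat n K) : (a * E k l).trace = a l k := by
  rw [Matrix.trace_mul_comm, trace_E_mul]

/-- The units `E l k` and `E k l` form dual bases for the trace form, so the operator remembers the
tensor. -/
theorem sum_contract_E (r : Mat n K ⊗[K] Mat n K) :
    ∑ k, ∑ l, contract r (E l k) ⊗ₜ[K] E k l = r := by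
  induction r with
  | zero => simp
  | add r s hr hs =>
    simp only [map_add, LinearMap.add_apply, TensorProduct.add_tmul, Finset.sum_add_distrib, hr, hs]
  | tmul x y =>
    simp only [contract_tmul, trace_mul_E, TensorProduct.smul_tmul, ← TensorProduct.tmul_sum]
    congr 1
    conv_rhs => rw [Matrix.matrix_eq_sum_single y]
    simp [E, Matrix.smul_single]

theorem contract_injective : Function.Injective (contract (n := n) (K := K)) := by
  intro r s h
  rw [← sum_contract_E r, ← sum_contract_E s, h]

theorem Ad_apply (X : GL (Fin n) K) (a : Mat n K) :
    Ad X a = (X : Mat n K) * a * ((X⁻¹ : GL (Fin n) K) : Mat n K) := by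
  simp [Ad, mul_assoc]

theorem contract_Ad₂ (X : GL (Fin n) K) (r : Mat n K ⊗[K] Mat n K) (a : Mat n K) :
    contract (Ad₂ X r) a = Ad X (contract r (Ad X⁻¹ a)) := by
  induction r with
  | zero => simp
  | add r s hr hs => simp only [map_add, LinearMap.add_apply, hr, hs]
  | tmul x y =>
    simp only [Ad₂, TensorProduct.map_tmul, contract_tmul, map_smul]
    congr 1
    rw [Ad_apply, Ad_apply, inv_inv, Matrix.trace_mul_comm, ← mul_assoc, ← mul_assoc,
      Matrix.trace_mul_comm, ← mul_assoc, ← mul_assoc, ← mul_assoc, Matrix.trace_mul_comm]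
    simp only [mul_assoc]

theorem contract_coboundary (r : Mat n K ⊗[K] Mat n K) (a b : Mat n K) :
    contract (coboundary r a) b =
      contract r (a * b - b * a) - (a * contract r b - contract r b * a) := by
  induction r with
  | zero => simp [coboundary]
  | add r s hr hs =>
    have : coboundary (r + s) a = coboundary r a + coboundary s a := by
      simp only [coboundary]; noncomm_ring
    rw [this]
    simp only [map_add, LinearMap.add_apply, hr, hs]
    noncomm_ring
  | tmul x y =>
    simp only [coboundary, mul_add, add_mul, Algebra.TensorProduct.tmul_mul_tmul, mul_one, one_mul,
      map_add, map_sub, LinearMap.add_apply, LinearMap.sub_apply, contract_tmul, mul_smul_comm,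
      smul_mul_assoc]
    rw [mul_assoc y a b, Matrix.trace_mul_comm (a * y) b, ← mul_assoc b a y,
      Matrix.trace_mul_comm (b * a) y]
    abel

theorem trace_contract_flip (r : Mat n K ⊗[K] Mat n K) (a b : Mat n K) :
    (contract (flipTensor r) a * b).trace = (a * contract r b).trace := by
  induction r with
  | zero => simp [flipTensor]
  | add r s hr hs =>
    simp only [flipTensor, map_add, LinearMap.add_apply, add_mul, mul_add,
      Matrix.trace_add] at hr hs ⊢
    rw [hr, hs]
  | tmul x y =>
    simp [flipTensor, Matrix.trace_mul_comm a x, mul_comm]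

/-- Contraction of the last two legs of `x ⊗ y ⊗ z` with `b` and `c`. -/
noncomputable def contract₃ (b c : Mat n K) :
    Mat n K ⊗[K] (Mat n K ⊗[K] Mat n K) →ₗ[K] Mat n K :=
  (TensorProduct.rid K (Mat n K)).toLinearMap ∘ₗ
    TensorProduct.map LinearMap.id
      ((TensorProduct.lid K K).toLinearMap ∘ₗ TensorProduct.map (trMul b) (trMul c))

@[simp] theorem contract₃_tmul (b c x y z : Mat n K) :
    contract₃ b c (x ⊗ₜ[K] (y ⊗ₜ[K] z)) = ((y * b).trace * (z * c).trace) • x := by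
  simp [contract₃]

theorem contract₃_leg₁₂_leg₁₃ (r s : Mat n K ⊗[K] Mat n K) (b c : Mat n K) :
    contract₃ b c (leg₁₂ K (Mat n K) r * leg₁₃ K (Mat n K) s -
      leg₁₃ K (Mat n K) s * leg₁₂ K (Mat n K) r) =
      contract r b * contract s c - contract s c * contract r b := by
  induction r with
  | zero => simp
  | add r r' hr hr' =>
    simp only [map_add, map_sub, LinearMap.add_apply, add_mul, mul_add] at hr hr' ⊢
    rw [add_sub_add_comm, hr, hr']; abel
  | tmul x y =>
    induction s with
    | zero => simp
    | add s s' hs hs' =>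
      simp only [map_add, map_sub, LinearMap.add_apply, add_mul, mul_add] at hs hs' ⊢
      rw [add_sub_add_comm, hs, hs']; abel
    | tmul x' y' =>
      simp only [leg₁₂, leg₁₃, Algebra.TensorProduct.map_tmul, AlgHom.id_apply,
        Algebra.TensorProduct.includeLeft_apply, Algebra.TensorProduct.includeRight_apply,
        Algebra.TensorProduct.tmul_mul_tmul, mul_one, one_mul, map_sub, contract₃_tmul,
        contract_tmul, smul_mul_assoc, mul_smul_comm, mul_smul]
      rw [smul_comm ((y' * c).trace) ((y * b).trace) (x * x')]

theorem contract₃_leg₁₂_leg₂₃ (r s : Mat n K ⊗[K] Mat n K) (b c : Mat n K) :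
    contract₃ b c (leg₁₂ K (Mat n K) r * leg₂₃ K (Mat n K) s -
      leg₂₃ K (Mat n K) s * leg₁₂ K (Mat n K) r) =
      contract r (contract s c * b - b * contract s c) := by
  induction r with
  | zero => simp
  | add r r' hr hr' =>
    simp only [map_add, map_sub, LinearMap.add_apply, add_mul, mul_add] at hr hr' ⊢
    rw [add_sub_add_comm, hr, hr']; abel
  | tmul x y =>
    induction s with
    | zero => simp
    | add s s' hs hs' =>
      simp only [map_add, map_sub, LinearMap.add_apply, add_mul, mul_add] at hs hs' ⊢
      rw [add_sub_add_comm, hs, hs']; abel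
    | tmul x' y' =>
      simp only [leg₁₂, leg₂₃, Algebra.TensorProduct.map_tmul, AlgHom.id_apply,
        Algebra.TensorProduct.includeLeft_apply, Algebra.TensorProduct.includeRight_apply,
        Algebra.TensorProduct.tmul_mul_tmul, mul_one, one_mul, map_sub, contract₃_tmul,
        contract_tmul, smul_mul_assoc, mul_smul_comm, map_smul]
      rw [← mul_smul, ← mul_smul, mul_comm ((y' * c).trace), mul_comm ((y' * c).trace),
        mul_assoc y x' b, mul_assoc x' y b, Matrix.trace_mul_comm x', mul_assoc y b x']

theorem contract₃_leg₁₃_leg₂₃ (r s : Mat n K ⊗[K] Mat n K) (b c : Mat n K) :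
    contract₃ b c (leg₁₃ K (Mat n K) r * leg₂₃ K (Mat n K) s -
      leg₂₃ K (Mat n K) s * leg₁₃ K (Mat n K) r) =
      contract r (contract (flipTensor s) b * c - c * contract (flipTensor s) b) := by
  induction r with
  | zero => simp
  | add r r' hr hr' =>
    simp only [map_add, map_sub, LinearMap.add_apply, add_mul, mul_add] at hr hr' ⊢
    rw [add_sub_add_comm, hr, hr']; abel
  | tmul x y =>
    induction s with
    | zero => simp [flipTensor]
    | add s s' hs hs' =>
      simp only [flipTensor, map_add, map_sub, LinearMap.add_apply, add_mul, mul_add] at hs hs' ⊢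
      rw [add_sub_add_comm, hs, hs']; abel
    | tmul x' y' =>
      simp only [leg₁₃, leg₂₃, flipTensor, Algebra.TensorProduct.map_tmul, AlgHom.id_apply,
        Algebra.TensorProduct.includeRight_apply, TensorProduct.comm_tmul,
        Algebra.TensorProduct.tmul_mul_tmul, mul_one, one_mul, map_sub, contract₃_tmul,
        contract_tmul, smul_mul_assoc, mul_smul_comm, map_smul]
      rw [← mul_smul, ← mul_smul,
        mul_assoc y y' c, mul_assoc y' y c, Matrix.trace_mul_comm y', mul_assoc y c y']

/-- The projection `a ↦ a - (tr a / n) 1` of `gl(n)` onto `sl(n)`. -/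
noncomputable def slProj (n : ℕ) (K : Type*) [Field K] : Mat n K →ₗ[K] Mat n K :=
  LinearMap.id - (Matrix.traceLinearMap (Fin n) K K).smulRight ((n : K)⁻¹ • (1 : Mat n K))

theorem slProj_apply (a : Mat n K) : slProj n K a = a - (a.trace * (n : K)⁻¹) • (1 : Mat n K) := by
  simp [slProj, mul_smul]

theorem trace_slProj [CharZero K] (a : Mat n K) : (slProj n K a).trace = 0 := by
  rcases Nat.eq_zero_or_pos n with rfl | hn
  · simp [Matrix.trace]
  · have : (n : K) ≠ 0 := by exact_mod_cast hn.ne'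
    simp [slProj_apply, this]

theorem slProj_of_trace_eq_zero {a : Mat n K} (h : a.trace = 0) : slProj n K a = a := by
  simp [slProj_apply, h]

theorem slProj_comm_left (a b : Mat n K) :
    slProj n K a * b - b * slProj n K a = a * b - b * a := by
  simp only [slProj_apply, sub_mul, mul_sub, smul_mul_assoc, mul_smul_comm, one_mul, mul_one]
  abel

/-- The symmetric part of an operator is half of the identity of `sl(n)`, i.e. the corresponding
tensor satisfies `r + r²¹ = Ω`. -/
def IsCasimirSplit (f : Mat n K →ₗ[K] Mat n K) : Prop :=
  ∀ a b, (f a * b).trace + (a * f b).trace = (slProj n K a * b).trace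

/-- The bracket `[x, y]_f = [f x, y] + [x, f y] - [x, y]`. -/
def opBracket (f : Mat n K →ₗ[K] Mat n K) (x y : Mat n K) : Mat n K :=
  (f x * y - y * f x) + (x * f y - f y * x) - (x * y - y * x)

/-- The classical Yang-Baxter equation in operator form. -/
def IsYangBaxterOp (f : Mat n K →ₗ[K] Mat n K) : Prop :=
  ∀ x y, f x * f y - f y * f x = f (opBracket f x y)

theorem ext_of_trace_mul {a b : Mat n K} (h : ∀ c, (a * c).trace = (b * c).trace) : a = b := by
  ext i j
  rw [← trace_mul_E j i a, ← trace_mul_E j i b, h]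

theorem isYangBaxterOp_contract {r : Mat n K ⊗[K] Mat n K} (hr : CYB r = 0)
    (hs : IsCasimirSplit (contract r)) : IsYangBaxterOp (contract r) := by
  intro b c
  -- The flip transposes the operator for the trace form, and the splitting expresses the transpose
  -- through the operator itself. The scalar correction in `slProj` disappears inside commutators.
  have hflip : contract (flipTensor r) b = slProj n K b - contract r b := by
    refine ext_of_trace_mul fun d => ?_
    rw [trace_contract_flip, sub_mul, Matrix.trace_sub, ← hs b d]
    ring
  have h := congrArg (contract₃ b c) hr
  rw [CYB, map_add, map_add, contract₃_leg₁₂_leg₁₃, contract₃_leg₁₂_leg₂₃, contract₃_leg₁₃_leg₂₃,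
    map_zero, hflip, sub_mul, mul_sub] at h
  have h2 := slProj_comm_left b c
  have h3 : slProj n K b * c - contract r b * c - (c * slProj n K b - c * contract r b) =
      (b * c - c * b) - (contract r b * c - c * contract r b) := by
    rw [← h2]; abel
  rw [h3, add_assoc, ← map_add] at h
  rw [eq_neg_of_add_eq_zero_left h, ← map_neg]
  congr 1
  simp only [opBracket]
  abel

theorem coboundary_neg (r : Mat n K ⊗[K] Mat n K) (a : Mat n K) :
    coboundary r (-a) = -coboundary r a := by
  have hneg : ∀ {R : Type _} [Ring R] (x y : R), x * -y - -y * x = -(x * y - y * x) := by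
    intro R _ x y; noncomm_ring
  have : ((-a) ⊗ₜ[K] 1 + 1 ⊗ₜ[K] (-a) : Mat n K ⊗[K] Mat n K) = -(a ⊗ₜ[K] 1 + 1 ⊗ₜ[K] a) := by
    rw [TensorProduct.neg_tmul, TensorProduct.tmul_neg, neg_add]
  rw [coboundary, this]
  exact hneg _ _

theorem commutator_commutator {R : Type*} [Ring R] (r x y : R) :
    r * (x * y - y * x) - (x * y - y * x) * r =
      (r * x - x * r) * y - y * (r * x - x * r) - ((r * y - y * r) * x - x * (r * y - y * r)) := by
  noncomm_ring

/-- This is the cocycle condition: a ↦ a ⊗ 1 + 1 ⊗ a preserves commutators, so it reduces to the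
Jacobi identity. -/
theorem coboundary_lie (r : Mat n K ⊗[K] Mat n K) (a b : Mat n K) :
    coboundary r (a * b - b * a) =
      coboundary (coboundary r a) b - coboundary (coboundary r b) a := by
  have : ((a * b - b * a) ⊗ₜ[K] 1 + 1 ⊗ₜ[K] (a * b - b * a) : Mat n K ⊗[K] Mat n K) =
      (a ⊗ₜ[K] 1 + 1 ⊗ₜ[K] a) * (b ⊗ₜ[K] 1 + 1 ⊗ₜ[K] b) -
        (b ⊗ₜ[K] 1 + 1 ⊗ₜ[K] b) * (a ⊗ₜ[K] 1 + 1 ⊗ₜ[K] a) := by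
    simp only [mul_add, add_mul, Algebra.TensorProduct.tmul_mul_tmul, mul_one, one_mul,
      TensorProduct.sub_tmul, TensorProduct.tmul_sub]
    abel
  simp only [coboundary, this]
  exact commutator_commutator _ _ _

/-- The bracket of a Yang-Baxter operator satisfies the Jacobi identity. -/
theorem opBracket_jacobi {f : Mat n K →ₗ[K] Mat n K} (hf : IsYangBaxterOp f) (x y z : Mat n K) :
    opBracket f x (opBracket f y z) + opBracket f y (opBracket f z x) +
      opBracket f z (opBracket f x y) = 0 := by
  -- Both f and f - 1 carry [ , ]_f to the commutator, and [x, u]_f = [f x, f u] - [(f - 1)x, (f -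
  -- 1)u]. The double bracket is thus a difference of two double commutators, each with vanishing
  -- cyclic sum.
  have key : ∀ x y z, opBracket f x (opBracket f y z) =
      (f x * (f y * f z - f z * f y) - (f y * f z - f z * f y) * f x) -
      ((f x - x) * ((f y - y) * (f z - z) - (f z - z) * (f y - y)) -
        ((f y - y) * (f z - z) - (f z - z) * (f y - y)) * (f x - x)) := by
    intro x y z
    have h1 := hf y z
    have h2 : (f y - y) * (f z - z) - (f z - z) * (f y - y) =
        f (opBracket f y z) - opBracket f y z := by
      rw [← h1, opBracket]; noncomm_ring
    rw [h1, h2]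
    generalize opBracket f y z = u
    rw [opBracket]
    noncomm_ring
  rw [key, key, key]
  noncomm_ring

end Contract

/-! ### The quadratic extension and its conjugation -/

section Conjugation

variable {F K : Type*} [Field F] [Field K] [Algebra F K]

/-- `K = F(s)` with `s² = d`, and `σ` is the conjugation `s ↦ -s`. -/
structure IsQuadraticConj (σ : K ≃ₐ[F] K) (d : F) (s : K) : Prop where
  sq : s * s = algebraMap F K d
  ne_zero : s ≠ 0
  conj : σ s = -s
  span : ∀ z : K, ∃ x y : F, z = algebraMap F K x + algebraMap F K y * s

theorem isQuadraticConj_of_adjoin {d : F} (hd : ¬ IsSquare d) {s : K}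
    (hs : s ^ 2 = algebraMap F K d) (hK : IntermediateField.adjoin F {s} = ⊤)
    {σ : K ≃ₐ[F] K} (hσ : σ s = -s) : IsQuadraticConj σ d s where
  sq := by rw [← hs, sq]
  ne_zero := by
    rintro rfl
    refine hd ⟨0, (algebraMap F K).injective ?_⟩
    rw [← hs]; simp
  conj := hσ
  span := by
    have hint : IsIntegral F s := .of_pow (n := 2) two_pos (hs ▸ isIntegral_algebraMap)
    intro z
    -- As s is algebraic, F(s) = F[s], so closure under ring operations is enough.
    have hz : z ∈ (IntermediateField.adjoin F {s}).toSubalgebra := by rw [hK]; trivial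
    rw [IntermediateField.adjoin_simple_toSubalgebra_of_isAlgebraic hint.isAlgebraic] at hz
    induction hz using Algebra.adjoin_induction with
    | mem x hx => exact ⟨0, 1, by simp_all⟩
    | algebraMap r => exact ⟨r, 0, by simp⟩
    | add x y _ _ hx hy =>
      obtain ⟨a, b, rfl⟩ := hx
      obtain ⟨a', b', rfl⟩ := hy
      exact ⟨a + a', b + b', by simp only [map_add]; ring⟩
    | mul x y _ _ hx hy =>
      obtain ⟨a, b, rfl⟩ := hx
      obtain ⟨a', b', rfl⟩ := hy
      refine ⟨a * a' + b * b' * d, a * b' + b * a', ?_⟩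
      simp only [map_add, map_mul, ← hs]; ring

variable {σ : K ≃ₐ[F] K} {d : F} {s : K}

theorem IsQuadraticConj.involutive (h : IsQuadraticConj σ d s) (z : K) : σ (σ z) = z := by
  obtain ⟨x, y, rfl⟩ := h.span z
  simp [h.conj]

theorem IsQuadraticConj.conj_inv (h : IsQuadraticConj σ d s) : σ s⁻¹ = -s⁻¹ := by
  rw [map_inv₀, h.conj, inv_neg]

end Conjugation

/-! ### The conjugate transpose on matrices and tensors -/

section Star

variable {F K : Type*} [Field F] [Field K] [Algebra F K] (σ : K ≃ₐ[F] K) {n : ℕ}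

@[simp] theorem starMat_apply (a : Mat n K) (i j : Fin n) : starMat σ a i j = σ (a j i) := rfl

theorem starMat_add (a b : Mat n K) : starMat σ (a + b) = starMat σ a + starMat σ b := by
  ext; simp

theorem starMat_sub (a b : Mat n K) : starMat σ (a - b) = starMat σ a - starMat σ b := by
  ext; simp

theorem starMat_smul (c : K) (a : Mat n K) : starMat σ (c • a) = σ c • starMat σ a := by
  ext; simp

theorem starMat_mul (a b : Mat n K) : starMat σ (a * b) = starMat σ b * starMat σ a := by
  ext; simp [Matrix.mul_apply, mul_comm]

@[simp] theorem starMat_one : starMat σ (1 : Mat n K) = 1 := by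
  ext i j; simp [Matrix.one_apply, eq_comm]

@[simp] theorem starMat_zero : starMat σ (0 : Mat n K) = 0 := by
  ext i j; simp

theorem trace_starMat (a : Mat n K) : (starMat σ a).trace = σ a.trace := by
  simp [Matrix.trace]

theorem slProj_starMat (a : Mat n K) : slProj n K (starMat σ a) = starMat σ (slProj n K a) := by
  simp [slProj_apply, starMat_sub, starMat_smul, trace_starMat]

theorem starMat_starMat (hσ : ∀ z, σ (σ z) = z) (a : Mat n K) : starMat σ (starMat σ a) = a := by
  ext; simp [hσ]

/-- `a ↦ a*` as a semilinear map. -/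
noncomputable def starₗ (n : ℕ) : Mat n K →ₛₗ[(σ : K →+* K)] Mat n K where
  toFun := starMat σ
  map_add' := starMat_add σ
  map_smul' := starMat_smul σ

/-- `a ⊗ b ↦ a* ⊗ b*`. -/
noncomputable def star₂ (n : ℕ) :
    Mat n K ⊗[K] Mat n K →ₛₗ[(σ : K →+* K)] Mat n K ⊗[K] Mat n K :=
  TensorProduct.map (starₗ σ n) (starₗ σ n)

@[simp] theorem star₂_tmul (a b : Mat n K) :
    star₂ σ n (a ⊗ₜ[K] b) = starMat σ a ⊗ₜ[K] starMat σ b := rfl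

variable {σ}

theorem contract_star₂ (hσ : ∀ z, σ (σ z) = z) (r : Mat n K ⊗[K] Mat n K) (a : Mat n K) :
    contract (star₂ σ n r) a = starMat σ (contract r (starMat σ a)) := by
  induction r with
  | zero => simp
  | add r r' hr hr' => simp only [map_add, LinearMap.add_apply, hr, hr', starMat_add]
  | tmul x y =>
    rw [star₂_tmul, contract_tmul, contract_tmul, starMat_smul, ← trace_starMat, starMat_mul,
      starMat_starMat σ hσ, Matrix.trace_mul_comm]

/-- Star reverses products, whence the sign; for skew-hermitian a it cancels against the sign of a*.
-/
theorem star₂_coboundary (hσ : ∀ z, σ (σ z) = z) (r : Mat n K ⊗[K] Mat n K) (a : Mat n K) :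
    star₂ σ n (coboundary r a) = -coboundary (star₂ σ n r) (starMat σ a) := by
  refine contract_injective (LinearMap.ext fun b => ?_)
  rw [contract_star₂ hσ, contract_coboundary, map_neg, LinearMap.neg_apply, contract_coboundary,
    contract_star₂ hσ, contract_star₂ hσ]
  simp only [starMat_sub, starMat_mul, starMat_starMat σ hσ, map_sub]
  noncomm_ring

theorem isCasimirSplit_star₂ (hσ : ∀ z, σ (σ z) = z) {r : Mat n K ⊗[K] Mat n K}
    (hr : IsCasimirSplit (contract r)) : IsCasimirSplit (contract (star₂ σ n r)) := by
  intro a b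
  have h := congrArg σ (hr (starMat σ a) (starMat σ b))
  rw [map_add, ← trace_starMat, ← trace_starMat, ← trace_starMat, slProj_starMat] at h
  simp only [starMat_mul, starMat_starMat σ hσ] at h
  rw [contract_star₂ hσ, contract_star₂ hσ, Matrix.trace_mul_comm _ b, Matrix.trace_mul_comm a,
    Matrix.trace_mul_comm _ b, h]

theorem suIncl₂_tmul (a b : su σ n) :
    suIncl₂ σ n (a ⊗ₜ[F] b) = (a : Mat n K) ⊗ₜ[K] (b : Mat n K) := rfl

theorem starMat_coe_su (a : su σ n) : starMat σ (a : Mat n K) = -(a : Mat n K) :=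
  eq_neg_of_add_eq_zero_left a.2.2

theorem star₂_suIncl₂ (t : su σ n ⊗[F] su σ n) : star₂ σ n (suIncl₂ σ n t) = suIncl₂ σ n t := by
  induction t with
  | zero => simp
  | add t t' h h' => simp only [map_add, h, h']
  | tmul a b =>
    rw [suIncl₂_tmul, star₂_tmul, starMat_coe_su, starMat_coe_su, TensorProduct.neg_tmul,
      TensorProduct.tmul_neg, neg_neg]

theorem starMat_smul_base (c : F) (a : Mat n K) : starMat σ (c • a) = c • starMat σ a := by
  ext; simp

theorem IsQuadraticConj.smul_eq {d : F} {s : K} (h : IsQuadraticConj σ d s) (a : Mat n K) :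
    s • a = d • s⁻¹ • a := by
  rw [← algebraMap_smul K d, ← h.sq, smul_smul, mul_assoc, mul_inv_cancel₀ h.ne_zero, mul_one]

/-- The sign appears because ∂t(a) = [t, a ⊗ 1 + 1 ⊗ a] has the tensor on the left. -/
theorem suIncl₂_adTensor (a : su σ n) (t : su σ n ⊗[F] su σ n) :
    suIncl₂ σ n (adTensor a t) = -coboundary (suIncl₂ σ n t) (a : Mat n K) := by
  induction t with
  | zero => simp [coboundary]
  | add t t' ht ht' =>
    simp only [map_add, ht, ht', coboundary]
    noncomm_ring
  | tmul b c =>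
    have hl : ∀ x y : su σ n, ((⁅x, y⁆ : su σ n) : Mat n K) = x * y - y * x := fun x y => rfl
    simp only [adTensor, LinearMap.add_apply, TensorProduct.map_tmul, LinearMap.id_apply, map_add,
      suIncl₂_tmul, LieAlgebra.ad_apply, hl, coboundary, mul_add, add_mul,
      Algebra.TensorProduct.tmul_mul_tmul, mul_one, one_mul, TensorProduct.sub_tmul,
      TensorProduct.tmul_sub]
    abel

end Star

/-! ### Invariant antisymmetric operators on gl(n) -/

section Invariants

variable {n : ℕ} {K : Type*} [Field K]

theorem E_mul_apply (i j p q : Fin n) (a : Mat n K) :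
    (E i j * a : Mat n K) p q = if p = i then a j q else 0 := by
  split_ifs with h
  · subst h; simp [E]
  · simp [E, h]

theorem mul_E_apply (i j p q : Fin n) (a : Mat n K) :
    (a * E i j : Mat n K) p q = if q = j then a p i else 0 := by
  split_ifs with h
  · subst h; simp [E]
  · simp [E, h]

theorem E_apply (i j p q : Fin n) : (E i j : Mat n K) p q = if p = i ∧ q = j then 1 else 0 := by
  simp [E, Matrix.single_apply, eq_comm]

theorem linearMap_ext_E {M : Type*} [AddCommMonoid M] [Module K M] {f g : Mat n K →ₗ[K] M}
    (h : ∀ i j, f (E i j) = g (E i j)) : f = g :=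
  Matrix.ext_linearMap K fun i j => LinearMap.ext_ring (h i j)

/-- An antisymmetric operator on `gl(n)` commuting with the adjoint action vanishes. -/
theorem eq_zero_of_antisymm_of_equivariant [CharZero K] {g : Mat n K →ₗ[K] Mat n K}
    (hanti : ∀ a b, (g a * b).trace + (a * g b).trace = 0)
    (hg : ∀ a b, g (a * b - b * a) = a * g b - g b * a) : g = 0 := by
  have hswap : ∀ a b, a * g b - g b * a = g a * b - b * g a := by
    intro a b
    rw [← hg, ← neg_sub (b * a), map_neg, hg]
    abel
  -- Weights: only multiples of E_ij have eigenvalue 1 under ad E_ii and -1 under ad E_jj, as 1 ≠ -1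
  -- in K.
  have hoff : ∀ i j, i ≠ j → g (E i j) = g (E i j) i j • E i j := by
    intro i j hij
    have h1 : (E i i * E i j - E i j * E i i : Mat n K) = E i j := by
      ext p q
      simp only [Matrix.sub_apply, mul_E_apply, E_apply]
      grind
    have h2 : (E j j * E i j - E i j * E j j : Mat n K) = -E i j := by
      ext p q
      simp only [Matrix.sub_apply, mul_E_apply, E_apply, Matrix.neg_apply]
      grind
    have h3 := hg (E i i) (E i j)
    have h4 := hg (E j j) (E i j)
    rw [h1] at h3
    rw [h2, map_neg] at h4
    ext p q
    have h3' := congrFun (congrFun h3 p) q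
    have h4' := congrFun (congrFun h4 p) q
    simp only [Matrix.sub_apply, Matrix.neg_apply, E_mul_apply, mul_E_apply] at h3' h4'
    simp only [Matrix.smul_apply, E_apply, smul_eq_mul]
    have two : (2 : K) ≠ 0 := two_ne_zero
    by_cases hp : p = i <;> by_cases hq : q = j <;> grind
  have hanti' : ∀ a, (g a * a).trace = 0 := by
    intro a
    have h := hanti a a
    rw [Matrix.trace_mul_comm a, ← two_mul] at h
    exact (mul_eq_zero.1 h).resolve_left two_ne_zero
  refine linearMap_ext_E fun i j => ?_
  rw [LinearMap.zero_apply]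
  rcases eq_or_ne i j with rfl | hij
  · have hcomm : ∀ p q, E p q * g (E i i) - g (E i i) * E p q = 0 := by
      intro p q
      rcases eq_or_ne p q with rfl | hpq
      · rw [← hg]
        convert map_zero g
        ext a b
        simp only [Matrix.sub_apply, mul_E_apply, E_apply, Matrix.zero_apply]
        grind
      -- Antisymmetry makes the coefficients of g at (p, q) and (q, p) opposite, while `hswap` makes
      -- them equal; so g kills E_pq.
      · rw [hswap, hoff p q hpq]
        have h := hanti (E p q) (E q p)
        rw [trace_mul_E, trace_E_mul] at h
        have h' := congrFun (congrFun (hswap (E p q) (E q p)) p) p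
        simp only [Matrix.sub_apply, E_mul_apply, mul_E_apply, if_true] at h'
        have h0 : g (E p q) p q = 0 := by
          have two : (2 : K) ≠ 0 := two_ne_zero
          grind
        simp [h0]
    -- By `hcomm`, g(E_ii) is a scalar matrix; one vanishing entry suffices.
    have hii : g (E i i) i i = 0 := by
      have := hanti' (E i i)
      rwa [trace_mul_E] at this
    ext p q
    rcases eq_or_ne p q with rfl | hpq
    · rcases eq_or_ne p i with rfl | hpi
      · exact hii
      · have := congrFun (congrFun (hcomm i p) i) p
        simp only [Matrix.sub_apply, E_mul_apply, mul_E_apply, if_true, Matrix.zero_apply,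
          hii] at this
        simpa using this
    · have := congrFun (congrFun (hcomm p p) p) q
      simp only [Matrix.sub_apply, E_mul_apply, mul_E_apply, if_true, Matrix.zero_apply,
        if_neg hpq.symm, sub_zero] at this
      exact this
  · rw [hoff i j hij]
    have h := hanti (E i j) (E j i)
    rw [trace_mul_E, trace_E_mul] at h
    have h' := congrFun (congrFun (hswap (E i j) (E j i)) i) i
    simp only [Matrix.sub_apply, E_mul_apply, mul_E_apply, if_true] at h'
    have h0 : g (E i j) i j = 0 := by
      have two : (2 : K) ≠ 0 := two_ne_zero
      grind
    simp [h0]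

end Invariants

/-! ### Descent to the real form su(n), and the dual Lie bracket -/

section RealForm

variable {F K : Type*} [Field F] [Field K] [Algebra F K] {σ : K ≃ₐ[F] K} {n : ℕ}
  {d : F} {s : K}

theorem slProj_slProj [CharZero K] (a : Mat n K) : slProj n K (slProj n K a) = slProj n K a :=
  slProj_of_trace_eq_zero (trace_slProj a)

/-- The projection of `gl(n, K)` onto its real form `su(n)`, killing hermitian matrices and
scalars. -/
noncomputable def suProj [CharZero K] (hσ : ∀ z, σ (σ z) = z) : Mat n K →ₗ[F] su σ n where
  toFun a := ⟨(2 : F)⁻¹ • (slProj n K a - starMat σ (slProj n K a)), by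
    constructor
    · rw [← slProj_starMat, ← map_sub, Matrix.trace_smul, trace_slProj, smul_zero]
    · rw [starMat_smul_base, starMat_sub, starMat_starMat σ hσ, ← smul_add]
      simp⟩
  map_add' a b := by
    ext1
    change _ = (2 : F)⁻¹ • (slProj n K a - starMat σ (slProj n K a)) +
      (2 : F)⁻¹ • (slProj n K b - starMat σ (slProj n K b))
    simp only [map_add, starMat_add, ← smul_add]
    congr 1
    abel
  map_smul' c a := by
    ext1
    have : slProj n K (c • a) = c • slProj n K a := by
      rw [← algebraMap_smul K c a, map_smul, algebraMap_smul]
    change _ = c • (2 : F)⁻¹ • (slProj n K a - starMat σ (slProj n K a))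
    simp only [this, starMat_smul_base, ← smul_sub]
    rw [smul_comm]

variable [CharZero K]

theorem coe_suProj (hσ : ∀ z, σ (σ z) = z) (a : Mat n K) :
    (suProj hσ a : Mat n K) = (2 : F)⁻¹ • (slProj n K a - starMat σ (slProj n K a)) := rfl

theorem suProj_coe [CharZero F] (hσ : ∀ z, σ (σ z) = z) (a : su σ n) :
    suProj hσ (a : Mat n K) = a := by
  ext1
  rw [coe_suProj, slProj_of_trace_eq_zero a.2.1, starMat_coe_su, sub_neg_eq_add, ← two_smul F,
    smul_smul, inv_mul_cancel₀ two_ne_zero, one_smul]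

theorem suProj_inv_smul_coe (h : IsQuadraticConj σ d s) (a : su σ n) :
    suProj h.involutive (s⁻¹ • (a : Mat n K)) = 0 := by
  ext1
  rw [coe_suProj, map_smul, slProj_of_trace_eq_zero a.2.1, starMat_smul, starMat_coe_su,
    h.conj_inv]
  simp

theorem suProj_smul (h : IsQuadraticConj σ d s) (a : Mat n K) :
    suProj h.involutive (s • a) = d • suProj h.involutive (s⁻¹ • a) := by
  rw [h.smul_eq, map_smul]

/-- The decomposition sl(n, K) = su(n) ⊕ s·su(n): multiplication by s exchanges skew-hermitian and
hermitian matrices. -/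
theorem slProj_eq_add [CharZero F] (h : IsQuadraticConj σ d s) (a : Mat n K) :
    slProj n K a = suProj h.involutive a + s • (suProj h.involutive (s⁻¹ • a) : Mat n K) := by
  rw [coe_suProj, coe_suProj, map_smul, starMat_smul, h.conj_inv, smul_comm s, smul_sub s,
    smul_smul s, smul_smul s, mul_neg, mul_inv_cancel₀ h.ne_zero, ← smul_add, neg_smul, one_smul]
  have : slProj n K a - starMat σ (slProj n K a) + (slProj n K a - -starMat σ (slProj n K a)) =
    (2 : F) • slProj n K a := by rw [two_smul]; abel
  rw [one_smul, this, smul_smul, inv_mul_cancel₀ two_ne_zero, one_smul]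

theorem starMat_slProj_eq_sub [CharZero F] (h : IsQuadraticConj σ d s) (a : Mat n K) :
    starMat σ (slProj n K a) =
      -(suProj h.involutive a : Mat n K) + s • (suProj h.involutive (s⁻¹ • a) : Mat n K) := by
  rw [slProj_eq_add h, starMat_add, starMat_smul, starMat_coe_su, starMat_coe_su, h.conj, neg_smul,
    smul_neg, neg_neg]

/-- Two `K`-linear maps on `gl(n, K)` agreeing on `su(n)` agree up to scalar matrices. -/
theorem linearMap_slProj_eq [CharZero F] {M : Type*} [AddCommGroup M] [Module K M]
    (h : IsQuadraticConj σ d s) {f g : Mat n K →ₗ[K] M} (hfg : ∀ a : su σ n, f a = g a)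
    (a : Mat n K) :
    f (slProj n K a) = g (slProj n K a) := by
  rw [slProj_eq_add h, map_add f, map_add g, map_smul f, map_smul g, hfg, hfg]

/-- The `F`-bilinear map underlying `realTensor`. -/
noncomputable def realTensorAux (h : IsQuadraticConj σ d s) :
    Mat n K →ₗ[F] Mat n K →ₗ[F] su σ n ⊗[F] su σ n :=
  (TensorProduct.mk F (su σ n) (su σ n)).compl₁₂ (suProj h.involutive) (suProj h.involutive) +
    d • (TensorProduct.mk F (su σ n) (su σ n)).compl₁₂
      (suProj h.involutive ∘ₗ (LinearMap.lsmul K (Mat n K) s⁻¹).restrictScalars F)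
      (suProj h.involutive ∘ₗ (LinearMap.lsmul K (Mat n K) s⁻¹).restrictScalars F)

theorem realTensorAux_apply (h : IsQuadraticConj σ d s) (a b : Mat n K) :
    realTensorAux h a b = suProj h.involutive a ⊗ₜ[F] suProj h.involutive b +
      d • (suProj h.involutive (s⁻¹ • a) ⊗ₜ[F] suProj h.involutive (s⁻¹ • b)) := rfl

/-- For a = p + s q and b = p' + s q' with components in su(n), the star-fixed part of a ⊗ b is p ⊗
p' + s² q ⊗ q', whence the factor d = s². Balancedness over K need only be checked for c = s. -/
theorem realTensorAux_smul (h : IsQuadraticConj σ d s) (c : K) (a b : Mat n K) :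
    realTensorAux h (c • a) b = realTensorAux h a (c • b) := by
  have hs : realTensorAux h (s • a) b = realTensorAux h a (s • b) := by
    rw [realTensorAux_apply, realTensorAux_apply, smul_smul, smul_smul,
      inv_mul_cancel₀ h.ne_zero, one_smul, one_smul, suProj_smul h a, suProj_smul h b,
      add_comm, TensorProduct.smul_tmul', TensorProduct.tmul_smul, TensorProduct.smul_tmul' d,
      TensorProduct.smul_tmul' d]
  obtain ⟨x, y, rfl⟩ := h.span c
  simp only [add_smul, mul_smul, map_add, LinearMap.add_apply, algebraMap_smul, map_smul,
    LinearMap.smul_apply, hs]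

/-- The projection of `gl(n, K) ⊗ gl(n, K)` onto the real form `su(n) ⊗ su(n)`. -/
noncomputable def realTensor (h : IsQuadraticConj σ d s) :
    Mat n K ⊗[K] Mat n K →+ su σ n ⊗[F] su σ n :=
  TensorProduct.liftAddHom
    (LinearMap.toAddMonoidHom'.comp (realTensorAux h).toAddMonoidHom)
    fun c a b => realTensorAux_smul h c a b

theorem realTensor_tmul (h : IsQuadraticConj σ d s) (a b : Mat n K) :
    realTensor h (a ⊗ₜ[K] b) = suProj h.involutive a ⊗ₜ[F] suProj h.involutive b +
      d • (suProj h.involutive (s⁻¹ • a) ⊗ₜ[F] suProj h.involutive (s⁻¹ • b)) := rfl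

theorem realTensor_smul (h : IsQuadraticConj σ d s) (c : F) (t : Mat n K ⊗[K] Mat n K) :
    realTensor h (c • t) = c • realTensor h t := by
  induction t with
  | zero => simp
  | add t t' ht ht' => simp only [smul_add, map_add, ht, ht']
  | tmul a b =>
    rw [TensorProduct.smul_tmul', realTensor_tmul, realTensor_tmul, map_smul, smul_comm s⁻¹ c a,
      map_smul, smul_add, smul_comm c d, TensorProduct.smul_tmul' c,
      TensorProduct.smul_tmul' c]

theorem realTensor_suIncl₂ [CharZero F] (h : IsQuadraticConj σ d s) (t : su σ n ⊗[F] su σ n) :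
    realTensor h (suIncl₂ σ n t) = t := by
  induction t with
  | zero => simp
  | add t t' ht ht' => simp only [map_add, ht, ht']
  | tmul a b =>
    rw [suIncl₂_tmul, realTensor_tmul, suProj_coe, suProj_coe, suProj_inv_smul_coe h,
      TensorProduct.zero_tmul, smul_zero, add_zero]

theorem suIncl₂_injective [CharZero F] (h : IsQuadraticConj σ d s) :
    Function.Injective (suIncl₂ σ n) :=
  Function.LeftInverse.injective (realTensor_suIncl₂ h)

theorem suIncl₂_realTensor [CharZero F] (h : IsQuadraticConj σ d s) (t : Mat n K ⊗[K] Mat n K) :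
    suIncl₂ σ n (realTensor h t) = (2 : F)⁻¹ • (TensorProduct.map (slProj n K) (slProj n K) t +
      star₂ σ n (TensorProduct.map (slProj n K) (slProj n K) t)) := by
  induction t with
  | zero => simp
  | add t t' ht ht' =>
    simp only [map_add, ht, ht', ← smul_add]
    congr 1
    abel
  | tmul a b =>
    rw [realTensor_tmul, map_add, map_smul, suIncl₂_tmul, suIncl₂_tmul, TensorProduct.map_tmul,
      star₂_tmul, starMat_slProj_eq_sub h, starMat_slProj_eq_sub h, slProj_eq_add h a,
      slProj_eq_add h b, ← algebraMap_smul K d, ← h.sq]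
    generalize (suProj h.involutive a : Mat n K) = p
    generalize (suProj h.involutive b : Mat n K) = p'
    generalize (suProj h.involutive (s⁻¹ • a) : Mat n K) = q
    generalize (suProj h.involutive (s⁻¹ • b) : Mat n K) = q'
    have : (p + s • q) ⊗ₜ[K] (p' + s • q') + (-p + s • q) ⊗ₜ[K] (-p' + s • q') =
        (2 : F) • (p ⊗ₜ[K] p' + (s * s) • q ⊗ₜ[K] q') := by
      simp only [TensorProduct.add_tmul, TensorProduct.tmul_add, TensorProduct.neg_tmul,
        TensorProduct.tmul_neg, TensorProduct.tmul_smul, two_smul, mul_smul,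
        ← TensorProduct.smul_tmul', smul_neg, smul_add]
      abel
    rw [this, smul_smul, inv_mul_cancel₀ two_ne_zero, one_smul]

/-- `φ` is the functional `a ↦ tr (a m)` on `su(n)`. -/
def RepresentedBy (φ : Module.Dual F (su σ n)) (m : Mat n K) : Prop :=
  ∀ a : su σ n, algebraMap F K (φ a) = ((a : Mat n K) * m).trace

/-- The `K`-linear extension of an `F`-linear functional on `su(n)`. -/
noncomputable def extendDual (h : IsQuadraticConj σ d s) (φ : Module.Dual F (su σ n)) :
    Mat n K →ₗ[K] K where
  toFun a := algebraMap F K (φ (suProj h.involutive a)) +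
    s * algebraMap F K (φ (suProj h.involutive (s⁻¹ • a)))
  map_add' a b := by
    simp only [map_add, smul_add]; ring
  map_smul' c a := by
    obtain ⟨x, y, rfl⟩ := h.span c
    simp only [add_smul, mul_smul, map_add, algebraMap_smul, map_smul, smul_add, smul_eq_mul,
      map_mul, RingHom.id_apply, smul_comm s⁻¹ x a, smul_comm s⁻¹ y (s • a), suProj_smul h,
      smul_smul s⁻¹ s, inv_mul_cancel₀ h.ne_zero, one_smul, ← h.sq]
    ring

theorem exists_representedBy [CharZero F] (h : IsQuadraticConj σ d s) (φ : Module.Dual F (su σ n)) :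
    ∃ m, RepresentedBy φ m := by
  -- The transposed indices come from tr(E_ji m) = m_ij.
  refine ⟨Matrix.of fun i j => extendDual h φ (E j i), fun a => ?_⟩
  have h1 : extendDual h φ a = algebraMap F K (φ a) := by
    change algebraMap F K (φ (suProj h.involutive a)) +
      s * algebraMap F K (φ (suProj h.involutive (s⁻¹ • (a : Mat n K)))) = _
    rw [suProj_coe, suProj_inv_smul_coe h]
    simp
  rw [← h1]
  change _ = trMul (Matrix.of fun i j => extendDual h φ (E j i)) (a : Mat n K)
  revert a
  suffices extendDual h φ = trMul (Matrix.of fun i j => extendDual h φ (E j i)) from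
    fun a _ => by rw [← this]
  refine linearMap_ext_E fun i j => ?_
  rw [trMul_apply, trace_E_mul]
  rfl

theorem algebraMap_dualDistrib {φ ψ : Module.Dual F (su σ n)} {m m' : Mat n K}
    (hφ : RepresentedBy φ m) (hψ : RepresentedBy ψ m') (t : su σ n ⊗[F] su σ n) :
    algebraMap F K (TensorProduct.dualDistrib F (su σ n) (su σ n) (φ ⊗ₜ[F] ψ) t) =
      (m * contract (suIncl₂ σ n t) m').trace := by
  induction t with
  | zero => simp
  | add t t' ht ht' =>
    simp only [map_add, ht, ht', LinearMap.add_apply, mul_add, Matrix.trace_add]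
  | tmul a b =>
    rw [TensorProduct.dualDistrib_apply, map_mul, hφ, hψ, suIncl₂_tmul, contract_tmul,
      mul_smul_comm, Matrix.trace_smul, smul_eq_mul, mul_comm, Matrix.trace_mul_comm m]

/-- Functionals on su(n) are represented by matrices through the trace form, and the transpose of ∂r
becomes [ , ]_f. The splitting moves f from [a, m'] onto m; cyclicity of the trace then isolates a.
-/
theorem representedBy_dualBracket {δ : su σ n →ₗ[F] su σ n ⊗[F] su σ n}
    {r : Mat n K ⊗[K] Mat n K} (hδ : ∀ a, suIncl₂ σ n (δ a) = coboundary r (a : Mat n K))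
    (hr : IsCasimirSplit (contract r)) {φ ψ : Module.Dual F (su σ n)} {m m' : Mat n K}
    (hφ : RepresentedBy φ m) (hψ : RepresentedBy ψ m') :
    RepresentedBy (dualBracket δ φ ψ) (opBracket (contract r) m m') := by
  intro a
  rw [dualBracket, LinearMap.comp_apply, algebraMap_dualDistrib hφ hψ, hδ, contract_coboundary]
  have h := hr m ((a : Mat n K) * m' - m' * a)
  have hsl : (slProj n K m * ((a : Mat n K) * m' - m' * a)).trace =
      (m * ((a : Mat n K) * m' - m' * a)).trace := by
    simp only [slProj_apply, sub_mul, Matrix.trace_sub, smul_mul_assoc, one_mul, Matrix.trace_smul]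
    rw [Matrix.trace_mul_comm (a : Mat n K) m']
    simp
  rw [hsl] at h
  rw [mul_sub, Matrix.trace_sub, ← sub_eq_iff_eq_add'.2 h.symm, opBracket]
  generalize contract r m = x
  generalize contract r m' = y
  simp only [mul_sub, mul_add, Matrix.trace_sub, Matrix.trace_add, ← mul_assoc]
  rw [Matrix.trace_mul_cycle m (a : Mat n K) m', Matrix.trace_mul_cycle m (a : Mat n K) y,
    Matrix.trace_mul_cycle x (a : Mat n K) m', Matrix.trace_mul_comm (m * y),
    Matrix.trace_mul_comm (m * m'),  Matrix.trace_mul_comm (x * m')]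
  simp only [← mul_assoc]
  rw [Matrix.trace_mul_cycle m' m, Matrix.trace_mul_cycle y m, Matrix.trace_mul_cycle m' x]
  ring

theorem coboundary_map_slProj (r : Mat n K ⊗[K] Mat n K)
    (hr : TensorProduct.map (slProj n K) (slProj n K) r = r) (a : Mat n K) :
    TensorProduct.map (slProj n K) (slProj n K) (coboundary r a) = coboundary r a := by
  have key : ∀ t : Mat n K ⊗[K] Mat n K,
      TensorProduct.map (slProj n K) (slProj n K)
        (coboundary (TensorProduct.map (slProj n K) (slProj n K) t) a) =
        coboundary (TensorProduct.map (slProj n K) (slProj n K) t) a := by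
    intro t
    induction t with
    | zero => simp [coboundary]
    | add t t' ht ht' =>
      have hadd : ∀ u v : Mat n K ⊗[K] Mat n K,
          coboundary (u + v) a = coboundary u a + coboundary v a := by
        intro u v; simp only [coboundary]; noncomm_ring
      simp only [map_add, hadd, ht, ht']
    | tmul x y =>
      have hc : ∀ x : Mat n K, slProj n K (x * a - a * x) = x * a - a * x := fun x =>
        slProj_of_trace_eq_zero (by rw [Matrix.trace_sub, Matrix.trace_mul_comm, sub_self])
      have : coboundary (slProj n K x ⊗ₜ[K] slProj n K y) a =
          (slProj n K x * a - a * slProj n K x) ⊗ₜ[K] slProj n K y +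
            slProj n K x ⊗ₜ[K] (slProj n K y * a - a * slProj n K y) := by
        simp only [coboundary, mul_add, add_mul, Algebra.TensorProduct.tmul_mul_tmul, mul_one,
          one_mul, TensorProduct.sub_tmul, TensorProduct.tmul_sub]
        abel
      rw [TensorProduct.map_tmul, this, map_add, TensorProduct.map_tmul, TensorProduct.map_tmul,
        hc, hc, slProj_slProj, slProj_slProj]
  have := key r
  rwa [hr] at this

/-- A Belavin-Drinfeld type `r`-matrix defines a Lie bialgebra structure on `su(n)` if and only if
it is fixed by the conjugation of `sl(n) ⊗ sl(n)` attached to `su(n) ⊗ su(n)`. -/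
theorem definesLieBialgebra_iff [CharZero F] (h : IsQuadraticConj σ d s) {r : Mat n K ⊗[K] Mat n K}
    (hsl : TensorProduct.map (slProj n K) (slProj n K) r = r)
    (hr : IsCasimirSplit (contract r)) (hyb : IsYangBaxterOp (contract r)) :
    DefinesLieBialgebra σ r ↔ star₂ σ n r = r := by
  constructor
  · rintro ⟨δ, -, hδ⟩
    have hstar : ∀ a : su σ n, coboundary (star₂ σ n r) (a : Mat n K) = coboundary r a := by
      intro a
      have h1 := star₂_suIncl₂ (δ a)
      rwa [hδ, star₂_coboundary h.involutive, starMat_coe_su, coboundary_neg, neg_neg] at h1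
    have hr' := isCasimirSplit_star₂ h.involutive hr
    -- The two operators have the same symmetric part, so their difference is antisymmetric; equal
    -- coboundaries on su(n) make it commute with ad a for a in su(n).
    have hzero : contract (star₂ σ n r) - contract r = 0 := by
      refine eq_zero_of_antisymm_of_equivariant ?_ ?_
      · intro a b
        simp only [LinearMap.sub_apply, sub_mul, mul_sub, Matrix.trace_sub]
        linear_combination hr' a b - hr a b
      · intro a b
        set g := contract (star₂ σ n r) - contract r with hg
        have hsu : ∀ a : su σ n, g (a * b - b * a) = a * g b - g b * a := by
          intro a
          have h1 := congrArg (fun t => contract t b) (hstar a)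
          simp only [contract_coboundary] at h1
          rw [hg]
          simp only [LinearMap.sub_apply, mul_sub, sub_mul]
          rw [sub_eq_iff_eq_add] at h1
          rw [h1]
          abel
        -- Equivariance is K-linear in a, so it extends from su(n) to sl(n, K), and scalars do not
        -- affect commutators.
        have h2 := linearMap_slProj_eq h
          (f := g ∘ₗ (LinearMap.mulRight K b - LinearMap.mulLeft K b))
          (g := LinearMap.mulRight K (g b) - LinearMap.mulLeft K (g b)) hsu a
        simp only [LinearMap.comp_apply, LinearMap.sub_apply, LinearMap.mulRight_apply,
          LinearMap.mulLeft_apply] at h2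
        rwa [slProj_comm_left, slProj_comm_left] at h2
    exact contract_injective (sub_eq_zero.1 hzero)
  · intro hstar
    -- The coboundary is star-fixed and has both legs in sl(n), so projecting it to the real form
    -- loses nothing.
    have hδ : ∀ a : su σ n, suIncl₂ σ n (realTensor h (coboundary r (a : Mat n K))) =
        coboundary r (a : Mat n K) := by
      intro a
      have h1 : star₂ σ n (coboundary r (a : Mat n K)) = coboundary r (a : Mat n K) := by
        rw [star₂_coboundary h.involutive, hstar, starMat_coe_su, coboundary_neg,
          neg_neg]
      rw [suIncl₂_realTensor, coboundary_map_slProj r hsl, h1, ← two_smul F, smul_smul,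
        inv_mul_cancel₀ two_ne_zero, one_smul]
    let δ : su σ n →ₗ[F] su σ n ⊗[F] su σ n :=
      { toFun := fun a => realTensor h (coboundary r (a : Mat n K))
        map_add' := fun a b => by
          rw [← map_add]
          congr 1
          change coboundary r ((a : Mat n K) + b) = _
          simp only [coboundary, TensorProduct.add_tmul, TensorProduct.tmul_add]
          noncomm_ring
        map_smul' := fun c a => by
          rw [RingHom.id_apply, ← realTensor_smul]
          congr 1
          change coboundary r (c • (a : Mat n K)) = _
          rw [← algebraMap_smul K c (a : Mat n K), ← algebraMap_smul K c]
          simp only [coboundary, ← TensorProduct.smul_tmul', TensorProduct.tmul_smul, ← smul_add,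
            mul_smul_comm, smul_mul_assoc, ← smul_sub] }
    have hδ' : ∀ a, suIncl₂ σ n (δ a) = coboundary r (a : Mat n K) := hδ
    have hinj : ∀ {φ : Module.Dual F (su σ n)}, RepresentedBy φ (0 : Mat n K) → φ = 0 := by
      intro φ hφ
      ext a
      have := hφ a
      rw [mul_zero, Matrix.trace_zero] at this
      simpa using this
    refine ⟨δ, ⟨?_, ?_, ?_⟩, hδ'⟩
    · intro φ
      obtain ⟨m, hm⟩ := exists_representedBy h φ
      have h1 := representedBy_dualBracket hδ' hr hm hm
      have h2 : opBracket (contract r) m m = 0 := by rw [opBracket]; abel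
      exact hinj (h2 ▸ h1)
    · intro φ ψ χ
      obtain ⟨m, hm⟩ := exists_representedBy h φ
      obtain ⟨m', hm'⟩ := exists_representedBy h ψ
      obtain ⟨m'', hm''⟩ := exists_representedBy h χ
      have e := fun {φ ψ m m'} =>
        representedBy_dualBracket hδ' hr (φ := φ) (ψ := ψ) (m := m) (m' := m')
      have h1 := e hm (e hm' hm'')
      have h2 := e hm' (e hm'' hm)
      have h3 := e hm'' (e hm hm')
      apply hinj
      intro a
      rw [← opBracket_jacobi hyb m m' m'', LinearMap.add_apply, LinearMap.add_apply, map_add,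
        map_add, h1 a, h2 a, h3 a, mul_add, mul_add, Matrix.trace_add, Matrix.trace_add]
    · intro a b
      apply suIncl₂_injective h
      rw [hδ', map_sub, suIncl₂_adTensor, suIncl₂_adTensor, hδ', hδ']
      change coboundary r ((a : Mat n K) * b - b * a) = _
      rw [coboundary_lie]
      abel

end RealForm

/-! ### Tensors in 𝔥 ⊗ 𝔥 -/

section Cartan

variable {n : ℕ} {K : Type*} [Field K]

theorem cartan₂_induction {P : Mat n K ⊗[K] Mat n K → Prop} {r : Mat n K ⊗[K] Mat n K}
    (hr : r ∈ cartan₂ n K) (zero : P 0) (add : ∀ r s, P r → P s → P (r + s))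
    (tmul : ∀ x ∈ cartan n K, ∀ y ∈ cartan n K, P (x ⊗ₜ[K] y)) : P r := by
  obtain ⟨t, rfl⟩ := hr
  induction t with
  | zero => simpa using zero
  | add t t' ht ht' => rw [map_add]; exact add _ _ ht ht'
  | tmul x y => exact tmul _ x.2 _ y.2

theorem trace_mul_of_isDiag {y : Mat n K} (hy : y.IsDiag) (a : Mat n K) :
    (y * a).trace = ∑ i, y i i * a i i := by
  simp only [Matrix.trace, Matrix.diag_apply, Matrix.mul_apply]
  refine Finset.sum_congr rfl fun i _ => ?_
  refine Finset.sum_eq_single i (fun j _ hj => ?_) (by simp)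
  rw [hy hj.symm, zero_mul]

theorem contract_cartan₂_isDiag {r : Mat n K ⊗[K] Mat n K} (hr : r ∈ cartan₂ n K) (a : Mat n K) :
    (contract r a).IsDiag := by
  refine cartan₂_induction (P := fun r => (contract r a).IsDiag) hr ?_ ?_ ?_
  · simp
  · intro r s hr hs
    rw [map_add]
    exact hr.add hs
  · intro x hx y _
    exact hx.1.smul _

theorem contract_cartan₂_congr {r : Mat n K ⊗[K] Mat n K} (hr : r ∈ cartan₂ n K) {a b : Mat n K}
    (hab : ∀ i, a i i = b i i) : contract r a = contract r b := by
  refine cartan₂_induction (P := fun r => contract r a = contract r b) hr ?_ ?_ ?_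
  · simp
  · intro r s hr hs
    simp only [map_add, LinearMap.add_apply, hr, hs]
  · intro x _ y hy
    rw [contract_tmul, contract_tmul, trace_mul_of_isDiag hy.1, trace_mul_of_isDiag hy.1]
    simp [hab]

theorem map_slProj_cartan₂ {r : Mat n K ⊗[K] Mat n K} (hr : r ∈ cartan₂ n K) :
    TensorProduct.map (slProj n K) (slProj n K) r = r := by
  refine cartan₂_induction (P := fun r => TensorProduct.map (slProj n K) (slProj n K) r = r)
    hr ?_ ?_ ?_
  · simp
  · intro r s hr hs
    simp only [map_add, hr, hs]
  · intro x hx y hy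
    rw [TensorProduct.map_tmul, slProj_of_trace_eq_zero hx.2, slProj_of_trace_eq_zero hy.2]

end Cartan

/-! ### Matrices with prescribed support -/

section SupportedOn

variable {ι : Type*} {K : Type*} [Field K]

/-- The matrices whose nonzero entries are at positions satisfying `P`. -/
def supportedOn (K : Type*) [Field K] (P : ι → ι → Prop) : Submodule K (Matrix ι ι K) where
  carrier := {a | ∀ i j, ¬ P i j → a i j = 0}
  add_mem' := fun ha hb i j h => by simp [ha i j h, hb i j h]
  zero_mem' := fun _ _ _ => rfl
  smul_mem' := fun c a ha i j h => by simp [ha i j h]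

theorem supportedOn_mono {P Q : ι → ι → Prop} (h : ∀ i j, P i j → Q i j) :
    supportedOn K P ≤ supportedOn K Q :=
  fun _ ha i j hij => ha i j fun hP => hij (h i j hP)

theorem E_mem_supportedOn {n : ℕ} {P : Fin n → Fin n → Prop} {i j : Fin n} (h : P i j) :
    (E i j : Mat n K) ∈ supportedOn K P := by
  intro p q hpq
  rw [E_apply, if_neg]
  rintro ⟨rfl, rfl⟩
  exact hpq h

end SupportedOn

/-! ### Iterates of τ on positive and simple roots -/

section Powers

variable {n : ℕ} (T : AdmissibleTriple n)

theorem mem_posRoots {α : Fin n × Fin n} : α ∈ posRoots n ↔ α.1 < α.2 := by simp [posRoots]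

theorem mem_supp {α : Fin n × Fin n} {a : Fin (n - 1)} :
    a ∈ supp α ↔ α.1.val ≤ a.val ∧ a.val < α.2.val := by simp [supp]

variable {T}

theorem AdmissibleTriple.PowEq.refl (α : Fin n × Fin n) : T.PowEq 0 α α :=
  ⟨by simp, by simp⟩

theorem AdmissibleTriple.PowEq.trans {k l : ℕ} {α β γ : Fin n × Fin n} (h : T.PowEq k α β)
    (h' : T.PowEq l β γ) : T.PowEq (k + l) α γ := by
  have key : ∀ m, (supp α).image T.τ^[k + m] = (supp β).image T.τ^[m] := by
    intro m
    rw [← h.2, Finset.image_image, ← Function.iterate_add, add_comm]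
  refine ⟨fun m hm => ?_, by rw [key, h'.2]⟩
  by_cases hk : m < k
  · exact h.1 m hk
  · obtain ⟨m, rfl⟩ := Nat.exists_eq_add_of_le (not_lt.1 hk)
    rw [key]
    exact h'.1 m (by omega)

/-- `τᵏ(α_a)` is defined and equal to `α_b`. -/
def AdmissibleTriple.SimplePowEq (T : AdmissibleTriple n) (k : ℕ) (a b : Fin (n - 1)) : Prop :=
  (∀ m < k, T.τ^[m] a ∈ T.Γ₁) ∧ T.τ^[k] a = b

theorem supp_simple (a : Fin (n - 1)) : supp (lo a, hi a) = {a} := by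
  ext b
  simp only [mem_supp, lo, hi, Finset.mem_singleton, Fin.ext_iff]
  omega

theorem powEq_simple_iff {k : ℕ} {a b : Fin (n - 1)} :
    T.PowEq k (lo a, hi a) (lo b, hi b) ↔ T.SimplePowEq k a b := by
  simp [AdmissibleTriple.PowEq, AdmissibleTriple.SimplePowEq, supp_simple]

theorem AdmissibleTriple.iterate_injOn (T : AdmissibleTriple n) {k : ℕ} {a b : Fin (n - 1)}
    (ha : ∀ m < k, T.τ^[m] a ∈ T.Γ₁) (hb : ∀ m < k, T.τ^[m] b ∈ T.Γ₁)
    (h : T.τ^[k] a = T.τ^[k] b) : a = b := by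
  induction k with
  | zero => exact h
  | succ k ih =>
    rw [Function.iterate_succ_apply', Function.iterate_succ_apply'] at h
    exact ih (fun m hm => ha m (by omega)) (fun m hm => hb m (by omega))
      (T.bijOn.injOn (ha k (by omega)) (hb k (by omega)) h)

/-- Each of the finitely many simple roots eventually leaves Γ₁, so one bound serves for all. This
is the source of the nilpotency in `IsTriangularOp`. -/
theorem AdmissibleTriple.exists_bound (T : AdmissibleTriple n) :
    ∃ N, ∀ k a, (∀ m < k, T.τ^[m] a ∈ T.Γ₁) → k < N := by
  have h : ∀ a, ∃ N, ∀ k, (∀ m < k, T.τ^[m] a ∈ T.Γ₁) → k < N := by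
    intro a
    by_cases ha : a ∈ T.Γ₁
    · obtain ⟨k, hk⟩ := T.nilpotent a ha
      exact ⟨k + 1, fun l hl => by by_contra hkl; exact hk (hl k (by omega))⟩
    · exact ⟨1, fun l hl => by by_contra hkl; exact ha (hl 0 (by omega))⟩
  choose N hN using h
  exact ⟨(Finset.univ.sup N), fun k a hk => lt_of_lt_of_le (hN a k hk) (Finset.le_sup (by simp))⟩

theorem AdmissibleTriple.PowEq.exists_bound (T : AdmissibleTriple n) :
    ∃ N, ∀ k (α β : Fin n × Fin n), α.1 < α.2 → T.PowEq k α β → k < N := by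
  obtain ⟨N, hN⟩ := T.exists_bound
  refine ⟨N, fun k α β hα h => ?_⟩
  have h2 := α.2.isLt
  refine hN k ⟨α.1.val, by omega⟩ fun m hm => h.1 m hm ?_
  refine Finset.mem_image_of_mem _ (mem_supp.2 ⟨le_rfl, ?_⟩)
  exact hα

/-- A positive root is simple if a power of `τ` maps it to a simple root. -/
theorem AdmissibleTriple.PowEq.simple {k : ℕ} {α β : Fin n × Fin n} (h : T.PowEq k α β)
    (hα : α.1 < α.2) (hβ : β.1.val + 1 = β.2.val) : α.1.val + 1 = α.2.val := by
  by_contra hne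
  have h2 := α.2.isLt
  have hlt : α.1.val < α.2.val := hα
  have hsub : ∀ c ∈ supp β, c.val = β.1.val := by
    intro c hc
    have := mem_supp.1 hc
    omega
  let a : Fin (n - 1) := ⟨α.1.val, by omega⟩
  let b : Fin (n - 1) := ⟨α.1.val + 1, by omega⟩
  have ha : a ∈ supp α := mem_supp.2 ⟨le_rfl, hlt⟩
  have hb : b ∈ supp α := mem_supp.2 ⟨by simp [b], by simp only [b]; omega⟩
  -- Two constituents of α would both be sent by τᵏ to the single simple root in β, against
  -- injectivity.
  have hab : a = b := by
    refine T.iterate_injOn (k := k) (fun m hm => h.1 m hm (Finset.mem_image_of_mem _ ha))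
      (fun m hm => h.1 m hm (Finset.mem_image_of_mem _ hb)) ?_
    ext
    rw [hsub, hsub]
    · rw [← h.2]; exact Finset.mem_image_of_mem _ hb
    · rw [← h.2]; exact Finset.mem_image_of_mem _ ha
  simp [a, b] at hab

end Powers

/-! ### The operator of a Belavin–Drinfeld r-matrix -/

section BDOperator

variable {n : ℕ} {K : Type*} [Field K] {T : AdmissibleTriple n} {e : RootVectors n K}
  {r₀ : Mat n K ⊗[K] Mat n K}

open Classical in
theorem contract_rOne (a : Mat n K) : contract (rOne T e) a =
    ∑ α ∈ posRoots n, a α.1 α.2 • E α.1 α.2 +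
      ∑ α ∈ posRoots n, ∑ k ∈ Finset.Ico 1 n, ∑ β ∈ posRoots n with T.PowEq k α β,
        (e.coeff α.1 α.2 * e.coeff β.2 β.1) •
          (a β.1 β.2 • E α.1 α.2 - a α.2 α.1 • E β.2 β.1) := by
  simp only [rOne, map_add, map_sum, LinearMap.add_apply, LinearMap.sum_apply, map_sub,
    LinearMap.sub_apply, contract_tmul, RootVectors.pos, RootVectors.neg, smul_mul_assoc,
    Matrix.trace_smul, trace_E_mul, smul_eq_mul]
  congr 1
  · refine Finset.sum_congr rfl fun α hα => ?_
    have hd := e.dual _ _ (mem_posRoots.1 hα).ne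
    rw [smul_smul]
    congr 1
    linear_combination a α.1 α.2 * hd
  · refine Finset.sum_congr rfl fun α _ => Finset.sum_congr rfl fun k _ =>
      Finset.sum_congr rfl fun β _ => ?_
    simp only [smul_sub, smul_smul]
    congr 2 <;> ring

-- On this subspace the operator is the identity plus a map that moves root vectors backwards along
-- τ, from β = τᵏ(α) to α.
open Classical in
theorem contract_bd_upper (h₀ : r₀ ∈ cartan₂ n K) {a : Mat n K}
    (ha : a ∈ supportedOn K (· < · : Fin n → Fin n → Prop)) :
    contract (r₀ + rOne T e) a = a +
      ∑ α ∈ posRoots n, ∑ k ∈ Finset.Ico 1 n, ∑ β ∈ posRoots n with T.PowEq k α β,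
        (e.coeff α.1 α.2 * e.coeff β.2 β.1 * a β.1 β.2) • E α.1 α.2 := by
  rw [map_add, LinearMap.add_apply,
    contract_cartan₂_congr h₀ (b := 0) (fun i => ha i i (lt_irrefl i)), map_zero, zero_add,
    contract_rOne]
  congr 1
  · ext i j
    simp only [Matrix.sum_apply, Matrix.smul_apply, E_apply, smul_eq_mul, mul_ite, mul_one,
      mul_zero]
    by_cases hij : i < j
    · rw [Finset.sum_eq_single (i, j)]
      · simp
      · rintro ⟨p, q⟩ _ hpq
        rw [if_neg]
        rintro ⟨rfl, rfl⟩
        exact hpq rfl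
      · exact fun h => absurd (mem_posRoots.2 hij) h
    · rw [ha i j hij]
      refine Finset.sum_eq_zero fun α hα => ?_
      rw [if_neg]
      rintro ⟨rfl, rfl⟩
      exact hij (mem_posRoots.1 hα)
  · refine Finset.sum_congr rfl fun α hα => Finset.sum_congr rfl fun k _ =>
      Finset.sum_congr rfl fun β _ => ?_
    rw [ha α.2 α.1 (mem_posRoots.1 hα).asymm, zero_smul, sub_zero, smul_smul]

-- Here there is no identity term, and negative root vectors move forwards along τ, from -α to
-- -τᵏ(α).
open Classical in
theorem contract_bd_lower (h₀ : r₀ ∈ cartan₂ n K) {a : Mat n K}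
    (ha : a ∈ supportedOn K (· > · : Fin n → Fin n → Prop)) :
    contract (r₀ + rOne T e) a =
      ∑ α ∈ posRoots n, ∑ k ∈ Finset.Ico 1 n, ∑ β ∈ posRoots n with T.PowEq k α β,
        (-(e.coeff α.1 α.2 * e.coeff β.2 β.1 * a α.2 α.1)) • E β.2 β.1 := by
  rw [map_add, LinearMap.add_apply,
    contract_cartan₂_congr h₀ (b := 0) (fun i => ha i i (lt_irrefl i)), map_zero, zero_add,
    contract_rOne]
  have hpos : ∀ α ∈ posRoots n, a α.1 α.2 = 0 := fun α hα => ha _ _ (mem_posRoots.1 hα).asymm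
  rw [Finset.sum_eq_zero (fun α hα => by rw [hpos α hα, zero_smul]), zero_add]
  refine Finset.sum_congr rfl fun α hα => Finset.sum_congr rfl fun k _ =>
      Finset.sum_congr rfl fun β hβ => ?_
  rw [hpos β (Finset.mem_filter.1 hβ).1, zero_smul, zero_sub, smul_neg, smul_smul, neg_smul]

theorem contract_bd_diag {a : Mat n K} (ha : a.IsDiag) :
    contract (r₀ + rOne T e) a = contract r₀ a := by
  classical
  rw [map_add, LinearMap.add_apply, contract_rOne]
  have hpos : ∀ α ∈ posRoots n, a α.1 α.2 = 0 := fun α hα => ha (mem_posRoots.1 hα).ne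
  have hneg : ∀ α ∈ posRoots n, a α.2 α.1 = 0 := fun α hα => ha (mem_posRoots.1 hα).ne'
  rw [Finset.sum_eq_zero (fun α hα => by rw [hpos α hα, zero_smul]), zero_add,
    Finset.sum_eq_zero, add_zero]
  refine fun α hα => Finset.sum_eq_zero fun k _ => Finset.sum_eq_zero fun β hβ => ?_
  rw [hpos β (Finset.mem_filter.1 hβ).1, hneg α hα]
  simp

/-- An operator on `gl(n)` respecting the triangular decomposition, nilpotent on the strictly lower
triangular matrices and unipotent on the strictly upper triangular ones. -/
structure IsTriangularOp (f : Mat n K →ₗ[K] Mat n K) : Prop where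
  upper : ∀ a ∈ supportedOn K (· < · : Fin n → Fin n → Prop),
    f a ∈ supportedOn K (· < · : Fin n → Fin n → Prop)
  lower : ∀ a ∈ supportedOn K (· > · : Fin n → Fin n → Prop),
    f a ∈ supportedOn K (· > · : Fin n → Fin n → Prop)
  diag : ∀ a : Mat n K, a.IsDiag → (f a).IsDiag
  nilpotent : ∃ N, ∀ a ∈ supportedOn K (· > · : Fin n → Fin n → Prop), (f ^ N) a = 0
  unipotent : ∃ N, ∀ a ∈ supportedOn K (· < · : Fin n → Fin n → Prop),
    ((1 - f) ^ N : Module.End K (Mat n K)) a = 0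

theorem pow_apply_mem_of_filtration {V : ℕ → Submodule K (Mat n K)} {f : Mat n K →ₗ[K] Mat n K}
    (hf : ∀ m, ∀ a ∈ V m, f a ∈ V (m + 1)) (m : ℕ) {a : Mat n K} (ha : a ∈ V 0) :
    (f ^ m) a ∈ V m := by
  induction m with
  | zero => exact ha
  | succ m ih =>
    rw [pow_succ', Module.End.mul_apply]
    exact hf m _ ih

theorem isTriangularOp_bd (h₀ : r₀ ∈ cartan₂ n K) :
    IsTriangularOp (contract (r₀ + rOne T e)) := by
  classical
  obtain ⟨N, hN⟩ := AdmissibleTriple.PowEq.exists_bound T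
  refine ⟨fun a ha => ?_, fun a ha => ?_, fun a ha => ?_, ⟨N, fun a ha => ?_⟩, ⟨N, fun a ha => ?_⟩⟩
  · rw [contract_bd_upper h₀ ha]
    refine add_mem ha (sum_mem fun α hα => sum_mem fun k _ => sum_mem fun β _ => ?_)
    exact Submodule.smul_mem _ _ (E_mem_supportedOn (mem_posRoots.1 hα))
  · rw [contract_bd_lower h₀ ha]
    refine (sum_mem fun α hα => sum_mem fun k _ => sum_mem fun β hβ => ?_)
    exact Submodule.smul_mem _ _
      (E_mem_supportedOn (mem_posRoots.1 (Finset.mem_filter.1 hβ).1))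
  · rw [contract_bd_diag ha]
    exact contract_cartan₂_isDiag h₀ a
  -- Filtration by how often a root has been reached through τ; the operator raises the level by at
  -- least one.
  · let V : ℕ → Submodule K (Mat n K) := fun m => supportedOn K fun i j =>
      j < i ∧ ∃ k ≥ m, ∃ α : Fin n × Fin n, α.1 < α.2 ∧ T.PowEq k α (j, i)
    have hV : (contract (r₀ + rOne T e) ^ N) a ∈ V N := by
      refine pow_apply_mem_of_filtration (fun m a ha => ?_) N ?_
      · rw [contract_bd_lower h₀ (supportedOn_mono (fun i j h => h.1) ha)]
        refine (sum_mem fun α hα => sum_mem fun k hk => sum_mem fun β hβ => ?_)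
        by_cases h : α.1 < α.2 ∧ ∃ k ≥ m, ∃ γ : Fin n × Fin n, γ.1 < γ.2 ∧ T.PowEq k γ α
        · obtain ⟨-, l, hl, γ, hγ, hp⟩ := h
          obtain ⟨hβ, hβ'⟩ := Finset.mem_filter.1 hβ
          have := (Finset.mem_Ico.1 hk).1
          exact Submodule.smul_mem _ _ (E_mem_supportedOn
            ⟨mem_posRoots.1 hβ, l + k, by omega, γ, hγ, hp.trans hβ'⟩)
        · rw [ha α.2 α.1 h]
          simp
      · exact supportedOn_mono (fun i j h => ⟨h, 0, le_rfl, (j, i), h, .refl _⟩) ha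
    ext i j
    refine hV i j ?_
    rintro ⟨-, k, hk, α, hα, hp⟩
    exact absurd (hN k α _ hα hp) (by omega)
  -- Filtration by how often τ can still be applied to a root; 1 - f raises the level by at least
  -- one.
  · let V : ℕ → Submodule K (Mat n K) := fun m => supportedOn K fun i j =>
      i < j ∧ ∃ k ≥ m, ∃ β : Fin n × Fin n, T.PowEq k (i, j) β
    have hV : ((1 - contract (r₀ + rOne T e)) ^ N : Module.End K (Mat n K)) a ∈ V N := by
      refine pow_apply_mem_of_filtration (fun m a ha => ?_) N ?_
      · rw [LinearMap.sub_apply, Module.End.one_apply,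
          contract_bd_upper h₀ (supportedOn_mono (fun i j h => h.1) ha), sub_add_cancel_left]
        refine neg_mem (sum_mem fun α hα => sum_mem fun k hk => sum_mem fun β hβ => ?_)
        by_cases h : β.1 < β.2 ∧ ∃ k ≥ m, ∃ γ : Fin n × Fin n, T.PowEq k β γ
        · obtain ⟨-, l, hl, γ, hp⟩ := h
          have := (Finset.mem_Ico.1 hk).1
          exact Submodule.smul_mem _ _ (E_mem_supportedOn
            ⟨mem_posRoots.1 hα, k + l, by omega, γ, (Finset.mem_filter.1 hβ).2.trans hp⟩)
        · rw [ha β.1 β.2 h]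
          simp
      · exact supportedOn_mono (fun i j h => ⟨h, 0, le_rfl, (i, j), .refl _⟩) ha
    ext i j
    refine hV i j ?_
    rintro ⟨hij, k, hk, β, hp⟩
    exact absurd (hN k (i, j) _ hij hp) (by omega)

theorem bd_simple_mem (h₀ : r₀ ∈ cartan₂ n K) {a : Mat n K}
    (ha : a ∈ supportedOn K fun i j : Fin n => i.val + 1 = j.val) :
    contract (r₀ + rOne T e) a ∈ supportedOn K fun i j : Fin n => i.val + 1 = j.val := by
  classical
  rw [contract_bd_upper h₀ (supportedOn_mono (fun i j h => Fin.lt_def.2 (by omega)) ha)]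
  refine add_mem ha (sum_mem fun α hα => sum_mem fun k hk => sum_mem fun β hβ => ?_)
  by_cases h : β.1.val + 1 = β.2.val
  · exact Submodule.smul_mem _ _
      (E_mem_supportedOn ((Finset.mem_filter.1 hβ).2.simple (mem_posRoots.1 hα) h))
  · rw [ha β.1 β.2 h]
    simp

theorem coeff_simple' (e : RootVectors n K) (a : Fin (n - 1)) : e.coeff (hi a) (lo a) = 1 := by
  have h := e.dual (lo a) (hi a) (by simp [lo, hi, Fin.ext_iff])
  rwa [e.simple, one_mul] at h

open Classical in
/-- The number of `k ≥ 1` with `τᵏ(α_a) = α_b`. -/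
noncomputable def powCount (T : AdmissibleTriple n) (a b : Fin (n - 1)) : ℕ :=
  ((Finset.Ico 1 n).filter fun k => T.SimplePowEq k a b).card

theorem lo_lt_hi (a : Fin (n - 1)) : lo a < hi a := by simp [lo, hi, Fin.lt_def]

theorem lo_injective : Function.Injective (lo (n := n)) := by
  intro a b h
  simpa [lo, Fin.ext_iff] using h

/-- Simple root vectors are normalized to matrix units, so these entries are integers depending on
the triple alone. -/
theorem bd_simple_apply (h₀ : r₀ ∈ cartan₂ n K) (a b : Fin (n - 1)) :
    contract (r₀ + rOne T e) (E (lo b) (hi b)) (lo a) (hi a) =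
      (if a = b then 1 else 0) + (powCount T a b : K) := by
  classical
  rw [contract_bd_upper h₀ (E_mem_supportedOn (lo_lt_hi b)), Matrix.add_apply]
  congr 1
  · rw [E_apply]
    congr 1
    refine propext ⟨fun h => lo_injective h.1, ?_⟩
    rintro rfl
    exact ⟨rfl, rfl⟩
  · simp only [Matrix.sum_apply, Matrix.smul_apply, E_apply, smul_eq_mul]
    rw [Finset.sum_eq_single (lo a, hi a)]
    · rw [powCount, Finset.card_filter, Nat.cast_sum]
      refine Finset.sum_congr rfl fun k _ => ?_
      rw [Finset.sum_filter, Finset.sum_eq_single (lo b, hi b)]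
      · simp only [powEq_simple_iff, e.simple, coeff_simple']
        simp
      · rintro ⟨p, q⟩ _ hpq
        have : ¬ (p = lo b ∧ q = hi b) := by
          rintro ⟨rfl, rfl⟩
          exact hpq rfl
        simp [this]
      · exact fun h => absurd (mem_posRoots.2 (lo_lt_hi b)) h
    · rintro ⟨p, q⟩ _ hpq
      have : ¬ (lo a = p ∧ hi a = q) := by
        rintro ⟨rfl, rfl⟩
        exact hpq rfl
      simp [this]
    · exact fun h => absurd (mem_posRoots.2 (lo_lt_hi a)) h

/-- The symmetric part of a Belavin-Drinfeld `r`-matrix is half of the Casimir element. -/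
theorem isCasimirSplit_bd (h : r₀ + flipTensor r₀ = casimirCartan n K) :
    IsCasimirSplit (contract (r₀ + rOne T e)) := by
  classical
  have hflip : contract (r₀ + rOne T e) + contract (flipTensor (r₀ + rOne T e)) = slProj n K := by
    have h1 : flipTensor (r₀ + rOne T e) = flipTensor r₀ + flipTensor (rOne T e) := map_add _ _ _
    have h2 : r₀ + rOne T e + (flipTensor r₀ + flipTensor (rOne T e)) =
        (r₀ + flipTensor r₀) + (rOne T e + flipTensor (rOne T e)) := by abel
    rw [h1, ← map_add, h2, h]
    -- The wedge terms cancel against their flips, and duality of the root vectors removes the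
    -- coefficients.
    have h3 : rOne T e + flipTensor (rOne T e) =
        ∑ α ∈ posRoots n, (E α.1 α.2 ⊗ₜ[K] E α.2 α.1 + E α.2 α.1 ⊗ₜ[K] E α.1 α.2) := by
      simp only [rOne, flipTensor, map_add, map_sum, map_sub, TensorProduct.comm_tmul]
      rw [add_add_add_comm, ← Finset.sum_add_distrib, ← Finset.sum_add_distrib]
      simp only [← Finset.sum_add_distrib, sub_add_sub_cancel, sub_self, Finset.sum_const_zero,
        add_zero]
      refine Finset.sum_congr rfl fun α hα => ?_
      have hd := e.dual _ _ (mem_posRoots.1 hα).ne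
      simp only [RootVectors.pos, RootVectors.neg, TensorProduct.tmul_smul,
        ← TensorProduct.smul_tmul', smul_smul]
      rw [hd, mul_comm, hd, one_smul, one_smul]
    rw [h3]
    ext1 a
    have hsum : ∑ i : Fin n, a i i • E i i +
        ∑ α ∈ posRoots n, (a α.1 α.2 • E α.1 α.2 + a α.2 α.1 • E α.2 α.1) = a := by
      ext i j
      simp only [Matrix.add_apply, Matrix.sum_apply, Matrix.smul_apply, E_apply, smul_eq_mul,
        Finset.sum_add_distrib, mul_ite, mul_one, mul_zero]
      rcases lt_trichotomy i j with hij | rfl | hij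
      · rw [Finset.sum_eq_zero, Finset.sum_eq_single (i, j), Finset.sum_eq_zero]
        · simp
        · rintro ⟨p, q⟩ hpq
          rw [if_neg]
          rintro ⟨rfl, rfl⟩
          exact hij.asymm (mem_posRoots.1 hpq)
        · rintro ⟨p, q⟩ _ hpq
          rw [if_neg]
          rintro ⟨rfl, rfl⟩
          exact hpq rfl
        · exact fun h => absurd (mem_posRoots.2 hij) h
        · intro k _
          rw [if_neg]
          rintro ⟨rfl, rfl⟩
          exact lt_irrefl _ hij
      · rw [Finset.sum_eq_single i, Finset.sum_eq_zero, Finset.sum_eq_zero]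
        · simp
        · rintro ⟨p, q⟩ hpq
          rw [if_neg]
          rintro ⟨rfl, rfl⟩
          exact lt_irrefl _ (mem_posRoots.1 hpq)
        · rintro ⟨p, q⟩ hpq
          rw [if_neg]
          rintro ⟨rfl, rfl⟩
          exact lt_irrefl _ (mem_posRoots.1 hpq)
        · intro k _ hk
          rw [if_neg]
          rintro ⟨rfl, -⟩
          exact hk rfl
        · simp
      · rw [Finset.sum_eq_zero, Finset.sum_eq_zero, Finset.sum_eq_single (j, i)]
        · simp
        · rintro ⟨p, q⟩ _ hpq
          rw [if_neg]
          rintro ⟨rfl, rfl⟩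
          exact hpq rfl
        · exact fun h => absurd (mem_posRoots.2 hij) h
        · rintro ⟨p, q⟩ hpq
          rw [if_neg]
          rintro ⟨rfl, rfl⟩
          exact hij.asymm (mem_posRoots.1 hpq)
        · intro k _
          rw [if_neg]
          rintro ⟨rfl, rfl⟩
          exact lt_irrefl _ hij
    simp only [casimirCartan, map_add, map_sub, map_sum, map_smul, LinearMap.add_apply,
      LinearMap.sub_apply, LinearMap.sum_apply, LinearMap.smul_apply, contract_tmul, trace_E_mul,
      one_mul]
    rw [slProj_apply, sub_add_eq_add_sub, hsum, mul_comm, mul_smul]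
  intro a b
  rw [← trace_contract_flip, Matrix.trace_mul_comm (contract _ a) b, ← hflip, LinearMap.add_apply,
    add_mul, Matrix.trace_add, Matrix.trace_mul_comm b]

theorem slProj_E {i j : Fin n} (hij : i ≠ j) : slProj n K (E i j) = E i j :=
  slProj_of_trace_eq_zero (by rw [← mul_one (E i j), trace_E_mul, Matrix.one_apply_ne hij.symm])

theorem slProj_pos {α : Fin n × Fin n} (hα : α ∈ posRoots n) :
    slProj n K (e.pos α) = e.pos α := by
  rw [RootVectors.pos, map_smul, slProj_E (mem_posRoots.1 hα).ne]

theorem slProj_neg {α : Fin n × Fin n} (hα : α ∈ posRoots n) :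
    slProj n K (e.neg α) = e.neg α := by
  rw [RootVectors.neg, map_smul, slProj_E (mem_posRoots.1 hα).ne']

open Classical in
theorem map_slProj_rOne :
    TensorProduct.map (slProj n K) (slProj n K) (rOne T e) = rOne T e := by
  rw [rOne, map_add, map_sum, map_sum]
  refine congrArg₂ (· + ·) (Finset.sum_congr rfl fun α hα => ?_)
    (Finset.sum_congr rfl fun α hα => ?_)
  · rw [TensorProduct.map_tmul, slProj_pos hα, slProj_neg hα]
  · rw [map_sum]
    refine Finset.sum_congr rfl fun k _ => ?_
    rw [map_sum]
    refine Finset.sum_congr rfl fun β hβ => ?_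
    rw [map_sub, TensorProduct.map_tmul, TensorProduct.map_tmul, slProj_pos hα,
      slProj_neg (Finset.mem_filter.1 hβ).1]

theorem map_slProj_bd (h₀ : r₀ ∈ cartan₂ n K) :
    TensorProduct.map (slProj n K) (slProj n K) (r₀ + rOne T e) = r₀ + rOne T e := by
  rw [map_add, map_slProj_cartan₂ h₀, map_slProj_rOne]

end BDOperator

/-! ### Intertwiners are triangular -/

section Intertwine

variable {ι : Type*} [Fintype ι] [DecidableEq ι] {K : Type*} [Field K]

theorem mul_single_mul_apply (Z W : Matrix ι ι K) (i j p q : ι) :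
    (Z * Matrix.single i j 1 * W : Matrix ι ι K) p q = Z p i * W j q := by
  rw [Matrix.mul_apply, Finset.sum_eq_single j]
  · simp
  · intro k _ hk
    rw [Matrix.mul_single_apply_of_ne _ _ _ _ _ hk, zero_mul]
  · simp

/-- If conjugation by `Z` intertwines an operator `f`, nilpotent on strictly triangular matrices,
with an operator `f'` respecting the triangular decomposition and injective on the opposite strictly
triangular matrices, then `Z` is triangular. -/
theorem triangular_of_intertwine (r : ι → ι → Prop) (irrefl : ∀ i, ¬ r i i)
    (trans : ∀ i j k, r i j → r j k → r i k) (trich : ∀ i j, r i j ∨ i = j ∨ r j i)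
    {f f' : Matrix ι ι K →ₗ[K] Matrix ι ι K} {Z W : Matrix ι ι K} (hWZ : W * Z = 1)
    (hint : ∀ a, f' (Z * a * W) = Z * f a * W)
    (hnil : ∃ N, ∀ a ∈ supportedOn K (fun i j => r j i), (f ^ N) a = 0)
    (hU : ∀ a ∈ supportedOn K r, f' a ∈ supportedOn K r)
    (hL : ∀ a ∈ supportedOn K (fun i j => ¬ r i j), f' a ∈ supportedOn K (fun i j => ¬ r i j))
    (hinj : ∀ a ∈ supportedOn K r, f' a = 0 → a = 0) {p i : ι} (hpi : r p i) : Z p i = 0 := by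
  classical
  obtain ⟨N, hN⟩ := hnil
  have asymm : ∀ i j, r i j → ¬ r j i := fun i j h h' => irrefl i (trans _ _ _ h h')
  have hpow : ∀ m a, (f' ^ m) (Z * a * W) = Z * (f ^ m) a * W := by
    intro m a
    induction m with
    | zero => simp
    | succ m ih => rw [pow_succ', pow_succ', Module.End.mul_apply, Module.End.mul_apply, ih, hint]
  have hUpow : ∀ m, ∀ a ∈ supportedOn K r, (f' ^ m) a ∈ supportedOn K r ∧
      ((f' ^ m) a = 0 → a = 0) := by
    intro m a ha
    induction m with
    | zero => exact ⟨ha, fun h => h⟩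
    | succ m ih =>
      rw [pow_succ', Module.End.mul_apply]
      exact ⟨hU _ ih.1, fun h => ih.2 (hinj _ ih.1 h)⟩
  have hLpow : ∀ m, ∀ a ∈ supportedOn K (fun i j => ¬ r i j),
      (f' ^ m) a ∈ supportedOn K (fun i j => ¬ r i j) := by
    intro m a ha
    induction m with
    | zero => exact ha
    | succ m ih =>
      rw [pow_succ', Module.End.mul_apply]
      exact hL _ ih
  -- B = Z E_ij W is killed by a power of f'. Since f' preserves both the strictly r-triangular part
  -- of B and the complementary part, and is injective on the former, that part vanishes.
  have hzero : ∀ i j, r j i → ∀ p q, r p q → Z p i * W j q = 0 := by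
    intro i j hji p q hpq
    set B : Matrix ι ι K := Z * Matrix.single i j 1 * W with hB
    have hE : (Matrix.single i j 1 : Matrix ι ι K) ∈ supportedOn K (fun i j => r j i) := by
      intro a b hab
      rw [Matrix.single_apply, if_neg]
      rintro ⟨rfl, rfl⟩
      exact hab hji
    have hB0 : (f' ^ N) B = 0 := by rw [hB, hpow, hN _ hE]; simp
    let BU : Matrix ι ι K := Matrix.of fun a b => if r a b then B a b else 0
    let BL : Matrix ι ι K := Matrix.of fun a b => if r a b then 0 else B a b
    have hsum : B = BU + BL := by
      ext a b
      simp only [BU, BL, Matrix.add_apply, Matrix.of_apply]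
      split_ifs <;> simp
    have hBU : BU ∈ supportedOn K r := fun a b h => by simp [BU, h]
    have hBL : BL ∈ supportedOn K (fun i j => ¬ r i j) := fun a b h => by
      simp [BL, not_not.1 h]
    have h0 : (f' ^ N) BU = 0 := by
      have hs : (f' ^ N) BU + (f' ^ N) BL = 0 := by rw [← map_add, ← hsum, hB0]
      ext a b
      by_cases hab : r a b
      · have := congrFun (congrFun hs a) b
        rw [Matrix.add_apply, hLpow N _ hBL a b (not_not.2 hab), add_zero] at this
        exact this
      · exact (hUpow N _ hBU).1 a b hab
    have h1 := congrFun (congrFun ((hUpow N _ hBU).2 h0) p) q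
    simp only [BU, Matrix.of_apply, if_pos hpq, Matrix.zero_apply] at h1
    rwa [hB, mul_single_mul_apply] at h1
  -- Now B is triangular with B² = 0, because E_ij² = 0 and W Z = 1; so its diagonal vanishes too.
  have hdiag : ∀ i j, r j i → ∀ p, Z p i * W j p = 0 := by
    intro i j hji p
    have hij : i ≠ j := by rintro rfl; exact irrefl _ hji
    have hsq : (Z * Matrix.single i j 1 * W) * (Z * Matrix.single i j 1 * W) = 0 := by
      calc _ = Z * Matrix.single i j 1 * (W * Z) * Matrix.single i j 1 * W := by
            simp only [Matrix.mul_assoc]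
        _ = 0 := by
            rw [hWZ, Matrix.mul_one, Matrix.mul_assoc Z,
              Matrix.single_mul_single_of_ne (h := hij.symm)]
            simp
    have h1 := congrFun (congrFun hsq p) p
    rw [Matrix.mul_apply, Finset.sum_eq_single p] at h1
    · rw [mul_single_mul_apply] at h1
      exact mul_self_eq_zero.1 h1
    · intro q _ hqp
      rw [mul_single_mul_apply, mul_single_mul_apply]
      rcases trich p q with h | h | h
      · rw [hzero i j hji p q h, zero_mul]
      · exact absurd h.symm hqp
      · rw [hzero i j hji q p h, mul_zero]
    · simp
  by_contra hne
  -- If Z p i ≠ 0, the rows of W before i live in the columns before p. Then W Z = 1 factors an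
  -- identity matrix indexed by the predecessors of i through the strictly smaller set of
  -- predecessors of p, against the rank bound.
  have hW : ∀ j q, r j i → ¬ r q p → W j q = 0 := by
    intro j q hj hq
    rcases trich p q with h | rfl | h
    · exact (mul_eq_zero.1 (hzero i j hj p q h)).resolve_left hne
    · exact (mul_eq_zero.1 (hdiag i j hj p)).resolve_left hne
    · exact absurd h hq
  let A : Matrix {j // r j i} {q // r q p} K := W.submatrix Subtype.val Subtype.val
  let B : Matrix {q // r q p} {j // r j i} K := Z.submatrix Subtype.val Subtype.val
  have hAB : A * B = 1 := by
    ext j l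
    have h1 := congrFun (congrFun hWZ j.1) l.1
    rw [Matrix.mul_apply] at h1
    rw [Matrix.mul_apply]
    have h2 : ∑ q ∈ Finset.univ.filter (fun q => r q p), W j.1 q * Z q l.1 =
        ∑ q : {q // r q p}, A j q * B q l :=
      Finset.sum_subtype _ (fun x => by simp) (fun q => W j.1 q * Z q l.1)
    rw [← h2, Finset.sum_filter_of_ne, h1, Matrix.one_apply, Matrix.one_apply]
    · simp [Subtype.ext_iff]
    · intro q _ hq
      by_contra hqp
      rw [hW j.1 q j.2 hqp, zero_mul] at hq
      exact hq rfl
  have hrank : Fintype.card {j // r j i} ≤ Fintype.card {q // r q p} := by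
    rw [← Matrix.rank_one (R := K) (n := {j // r j i}), ← hAB]
    exact (Matrix.rank_mul_le_left A B).trans (Matrix.rank_le_card_width A)
  refine absurd hrank (not_le.2 ?_)
  rw [Fintype.card_subtype, Fintype.card_subtype]
  refine Finset.card_lt_card ⟨fun q hq => ?_, fun h => ?_⟩
  · simp only [Finset.mem_filter_univ] at hq ⊢
    exact trans _ _ _ hq hpi
  · have := h (Finset.mem_filter_univ p |>.2 hpi)
    exact irrefl p (by simpa using this)

end Intertwine

/-! ### Rigidity of triangular Yang–Baxter operators -/

section Triangular

variable {n : ℕ} {K : Type*} [Field K] {f f' : Mat n K →ₗ[K] Mat n K}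

theorem IsTriangularOp.injOn_upper (hf : IsTriangularOp f) {a : Mat n K}
    (ha : a ∈ supportedOn K (· < · : Fin n → Fin n → Prop)) (h : f a = 0) : a = 0 := by
  obtain ⟨N, hN⟩ := hf.unipotent
  rw [← hN a ha]
  clear hN
  induction N with
  | zero => rfl
  | succ N ih =>
    rw [pow_succ', Module.End.mul_apply, ← ih]
    simp [h]

theorem IsTriangularOp.injOn_lower (hf : IsTriangularOp f) {a : Mat n K}
    (ha : a ∈ supportedOn K (· > · : Fin n → Fin n → Prop)) (h : (1 - f) a = 0) : a = 0 := by
  obtain ⟨N, hN⟩ := hf.nilpotent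
  rw [← hN a ha]
  clear hN
  have h1 : f a = a := (sub_eq_zero.1 h).symm
  induction N with
  | zero => rfl
  | succ N ih => rw [pow_succ', Module.End.mul_apply, ← ih, h1]

/-- The sum of the strictly lower, diagonal, and strictly upper triangular parts. -/
theorem exists_triangular_decomposition (a : Mat n K) :
    ∃ l ∈ supportedOn K (· > · : Fin n → Fin n → Prop), ∃ h : Mat n K, h.IsDiag ∧
      ∃ u ∈ supportedOn K (· < · : Fin n → Fin n → Prop), a = l + h + u := by
  refine ⟨Matrix.of fun i j => if j < i then a i j else 0, fun i j h => by simp_all,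
    Matrix.diagonal fun i => a i i, Matrix.isDiag_diagonal _,
    Matrix.of fun i j => if i < j then a i j else 0, fun i j h => by simp_all, ?_⟩
  ext i j
  simp only [Matrix.add_apply, Matrix.of_apply, Matrix.diagonal_apply]
  rcases lt_trichotomy i j with h | rfl | h
  · simp [h, h.asymm, h.ne]
  · simp
  · simp [h, h.asymm, h.ne']

theorem IsTriangularOp.lower_diag (hf : IsTriangularOp f) (a : Mat n K)
    (ha : a ∈ supportedOn K (fun i j : Fin n => ¬ i < j)) :
    f a ∈ supportedOn K (fun i j : Fin n => ¬ i < j) := by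
  obtain ⟨l, hl, h, hh, u, hu, rfl⟩ := exists_triangular_decomposition a
  have : u = 0 := by
    ext i j
    by_cases hij : i < j
    · have := ha i j (not_not.2 hij)
      simpa [hl i j hij.asymm, hh hij.ne] using this
    · exact hu i j hij
  subst this
  intro i j hij
  have hij : i < j := not_not.1 hij
  rw [add_zero, map_add, Matrix.add_apply, hf.lower l hl i j hij.asymm, hf.diag h hh hij.ne,
    add_zero]

theorem IsTriangularOp.upper_diag (hf : IsTriangularOp f) (a : Mat n K)
    (ha : a ∈ supportedOn K (fun i j : Fin n => ¬ j < i)) :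
    f a ∈ supportedOn K (fun i j : Fin n => ¬ j < i) := by
  obtain ⟨l, hl, h, hh, u, hu, rfl⟩ := exists_triangular_decomposition a
  have : l = 0 := by
    ext i j
    by_cases hij : j < i
    · have := ha i j (not_not.2 hij)
      simpa [hu i j hij.asymm, hh hij.ne'] using this
    · exact hl i j hij
  subst this
  intro i j hij
  have hij : j < i := not_not.1 hij
  rw [zero_add, map_add, Matrix.add_apply, hf.upper u hu i j hij.asymm, hf.diag h hh hij.ne',
    add_zero]

/-- A matrix whose conjugation intertwines two operators of Belavin-Drinfeld type is diagonal. -/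
theorem isDiag_of_intertwine (hf : IsTriangularOp f) (hf' : IsTriangularOp f') {Z W : Mat n K}
    (hWZ : W * Z = 1) (hint : ∀ a, f' (Z * a * W) = Z * f a * W) : Z.IsDiag := by
  intro p i hpi
  rcases lt_or_gt_of_ne hpi with h | h
  · exact triangular_of_intertwine (· < ·) (fun i => lt_irrefl i) (fun _ _ _ => lt_trans)
      lt_trichotomy hWZ hint hf.nilpotent hf'.upper hf'.lower_diag
      (fun a ha => hf'.injOn_upper ha) h
  -- Passing to 1 - f exchanges the roles of upper and lower triangular matrices.
  · refine triangular_of_intertwine (f := 1 - f) (f' := 1 - f') (· > ·) (fun i => lt_irrefl i)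
      (fun _ _ _ h h' => lt_trans h' h) (fun i j => lt_trichotomy j i |>.imp_right
        (Or.imp_left Eq.symm)) hWZ ?_ hf.unipotent (fun a ha => sub_mem ha (hf'.lower a ha))
      (fun a ha => sub_mem ha (hf'.upper_diag a ha)) (fun a ha => hf'.injOn_lower ha) h
    intro a
    simp only [LinearMap.sub_apply, Module.End.one_apply, hint, mul_sub, sub_mul]

theorem eq_sum_simple {a : Mat n K}
    (ha : a ∈ supportedOn K fun i j : Fin n => i.val + 1 = j.val) :
    a = ∑ b : Fin (n - 1), a (lo b) (hi b) • E (lo b) (hi b) := by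
  ext i j
  simp only [Matrix.sum_apply, Matrix.smul_apply, E_apply, smul_eq_mul, mul_ite, mul_one, mul_zero]
  by_cases hij : i.val + 1 = j.val
  · have hj := j.isLt
    have hi' : i = lo ⟨i.val, by omega⟩ := rfl
    have hj' : j = hi ⟨i.val, by omega⟩ := Fin.ext hij.symm
    rw [Finset.sum_eq_single ⟨i.val, by omega⟩]
    · rw [if_pos ⟨hi', hj'⟩, ← hi', ← hj']
    · intro b _ hb
      rw [if_neg]
      rintro ⟨h, -⟩
      exact hb (lo_injective (h.symm.trans hi'))
    · simp
  · rw [ha i j hij, Finset.sum_eq_zero]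
    intro b _
    rw [if_neg]
    rintro ⟨rfl, rfl⟩
    exact hij rfl

theorem E_mul_E (i j k : Fin n) : (E i j * E j k : Mat n K) = E i k := by
  simp [E]

theorem E_mul_E_of_ne (i l : Fin n) {j k : Fin n} (h : j ≠ k) :
    (E i j * E k l : Mat n K) = 0 :=
  Matrix.single_mul_single_of_ne (h := h) ..

theorem mul_mem_upper {a b : Mat n K} (ha : a ∈ supportedOn K (· < · : Fin n → Fin n → Prop))
    (hb : b ∈ supportedOn K (· < · : Fin n → Fin n → Prop)) :
    a * b ∈ supportedOn K (· < · : Fin n → Fin n → Prop) := by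
  intro i j hij
  rw [Matrix.mul_apply]
  refine Finset.sum_eq_zero fun k _ => ?_
  by_cases hik : i < k
  · rw [hb k j (fun hkj => hij (hik.trans hkj)), mul_zero]
  · rw [ha i k hik, zero_mul]

theorem eq_sum_E (a : Mat n K) : a = ∑ i, ∑ j, a i j • E i j := by
  conv_lhs => rw [Matrix.matrix_eq_sum_single a]
  simp [E, Matrix.smul_single]

/-- The upper triangular matrices are generated by the simple root vectors. -/
theorem upper_le_of_simple_mem {Q : Submodule K (Mat n K)}
    (hsimple : ∀ b : Fin (n - 1), E (lo b) (hi b) ∈ Q)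
    (hbr : ∀ a ∈ Q, ∀ b ∈ Q, a * b - b * a ∈ Q) :
    supportedOn K (· < · : Fin n → Fin n → Prop) ≤ Q := by
  have hE : ∀ m : ℕ, ∀ i j : Fin n, i.val + m + 1 = j.val → (E i j : Mat n K) ∈ Q := by
    intro m
    induction m with
    | zero =>
      intro i j hij
      have hj := j.isLt
      have : j = hi ⟨i.val, by omega⟩ := Fin.ext hij.symm
      rw [this]
      exact hsimple ⟨i.val, by omega⟩
    | succ m ih =>
      intro i j hij
      have hj := j.isLt
      let c : Fin (n - 1) := ⟨i.val + m + 1, by omega⟩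
      have hjc : j = hi c := Fin.ext hij.symm
      have h := hbr _ (ih i (lo c) rfl) _ (hsimple c)
      rwa [E_mul_E, E_mul_E_of_ne _ _ (by simp [hi, c, Fin.ext_iff]; omega), sub_zero, ← hjc] at h
  intro a ha
  rw [eq_sum_E a]
  refine sum_mem fun i _ => sum_mem fun j _ => ?_
  by_cases hij : i < j
  · exact Q.smul_mem _ (hE (j.val - i.val - 1) i j (by have := Fin.lt_def.1 hij; omega))
  · rw [ha i j hij, zero_smul]
    exact zero_mem _

/-- An operator of Belavin-Drinfeld type is determined by its values on diagonal matrices and on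
simple root vectors. -/
theorem eq_of_eq_simple (hf : IsTriangularOp f) (hf' : IsTriangularOp f') (hc : IsCasimirSplit f)
    (hc' : IsCasimirSplit f') (hyb : IsYangBaxterOp f) (hyb' : IsYangBaxterOp f')
    (hmem : ∀ a ∈ supportedOn K (fun i j : Fin n => i.val + 1 = j.val),
      f a ∈ supportedOn K (fun i j : Fin n => i.val + 1 = j.val))
    (hdiag : ∀ a : Mat n K, a.IsDiag → f' a = f a)
    (hsimple : ∀ b : Fin (n - 1), f' (E (lo b) (hi b)) = f (E (lo b) (hi b))) : f' = f := by
  let U : Submodule K (Mat n K) := supportedOn K (· < · : Fin n → Fin n → Prop)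
  let V₁ : Submodule K (Mat n K) := supportedOn K (fun i j : Fin n => i.val + 1 = j.val)
  have hVU : V₁ ≤ U := supportedOn_mono fun i j h => Fin.lt_def.2 (by omega)
  have heq : ∀ a ∈ V₁, f' a = f a := by
    intro a ha
    rw [eq_sum_simple ha, map_sum, map_sum]
    exact Finset.sum_congr rfl fun b _ => by rw [map_smul, map_smul, hsimple]
  have hsurj : ∀ a ∈ V₁, ∃ x ∈ V₁, f x = a := by
    have hinj : Function.Injective (f.restrict hmem) := by
      rw [injective_iff_map_eq_zero]
      intro x hx
      exact Subtype.ext (hf.injOn_upper (hVU x.2) (congrArg Subtype.val hx))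
    intro a ha
    obtain ⟨x, hx⟩ := LinearMap.injective_iff_surjective.1 hinj ⟨a, ha⟩
    exact ⟨x, x.2, congrArg Subtype.val hx⟩
  -- Q collects the common values of f and f' at common arguments. If f x = f' x and f y = f' y,
  -- then [x, y]_f = [x, y]_f', so Yang–Baxter puts [f x, f y] in Q: it is a subalgebra. It contains
  -- the simple root vectors because f is bijective on their span.
  let Q : Submodule K (Mat n K) :=
    { carrier := {a | ∃ x ∈ U, f x = a ∧ f' x = a}
      add_mem' := by
        rintro a b ⟨x, hx, h1, h2⟩ ⟨y, hy, h3, h4⟩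
        exact ⟨x + y, add_mem hx hy, by rw [map_add, h1, h3], by rw [map_add, h2, h4]⟩
      zero_mem' := ⟨0, zero_mem _, map_zero _, map_zero _⟩
      smul_mem' := by
        rintro c a ⟨x, hx, h1, h2⟩
        exact ⟨c • x, U.smul_mem c hx, by rw [map_smul, h1], by rw [map_smul, h2]⟩ }
  have hQ : U ≤ Q := by
    refine upper_le_of_simple_mem (fun b => ?_) ?_
    · obtain ⟨x, hx, h⟩ := hsurj (E (lo b) (hi b)) (E_mem_supportedOn rfl)
      exact ⟨x, hVU hx, h, (heq x hx).trans h⟩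
    · rintro _ ⟨x, hx, rfl, h1⟩ _ ⟨y, hy, rfl, h2⟩
      have hu : opBracket f' x y = opBracket f x y := by rw [opBracket, opBracket, h1, h2]
      refine ⟨opBracket f x y, ?_, (hyb x y).symm, ?_⟩
      · have hfx := hf.upper x hx
        have hfy := hf.upper y hy
        exact sub_mem (add_mem (sub_mem (mul_mem_upper hfx hy) (mul_mem_upper hy hfx))
          (sub_mem (mul_mem_upper hx hfy) (mul_mem_upper hfy hx)))
          (sub_mem (mul_mem_upper hx hy) (mul_mem_upper hy hx))
      · rw [← hu, ← hyb' x y, h1, h2]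
  have hU : ∀ a ∈ U, f' a = f a := by
    intro a ha
    obtain ⟨x, hx, h1, h2⟩ := hQ (hf.upper a ha)
    have : x - a = 0 := hf.injOn_upper (sub_mem hx ha) (by rw [map_sub, h1, sub_self])
    rw [sub_eq_zero.1 this] at h2
    exact h2
  refine linearMap_ext_E fun i j => ?_
  rcases lt_trichotomy i j with hij | rfl | hij
  · exact hU _ (E_mem_supportedOn hij)
  · refine hdiag _ fun p q hpq => ?_
    change (E i i : Mat n K) p q = 0
    rw [E_apply, if_neg]
    rintro ⟨rfl, rfl⟩
    exact hpq rfl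
  · have hL : (E i j : Mat n K) ∈ supportedOn K (· > · : Fin n → Fin n → Prop) :=
      E_mem_supportedOn hij
    ext p q
    by_cases hpq : q < p
    -- By the splitting, the values on strictly upper matrices determine those on strictly lower
    -- ones by transposition.
    · rw [← trace_mul_E q p (f' _), ← trace_mul_E q p (f _)]
      have h1 := hc (E i j) (E q p)
      have h2 := hc' (E i j) (E q p)
      rw [hU _ (E_mem_supportedOn hpq)] at h2
      linear_combination h2 - h1
    · rw [hf.lower _ hL p q hpq, hf'.lower _ hL p q hpq]

end Triangular

/-! ### The adjoint action and the matrix S -/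

section AdAction

variable {n : ℕ} {K : Type*} [Field K]

theorem Ad_mul_apply (X Y : GL (Fin n) K) (a : Mat n K) : Ad (X * Y) a = Ad X (Ad Y a) := by
  simp only [Ad_apply, mul_inv_rev, Units.val_mul, mul_assoc]

theorem Ad_one_apply (a : Mat n K) : Ad 1 a = a := by simp [Ad_apply]

theorem Ad_inv_Ad (X : GL (Fin n) K) (a : Mat n K) : Ad X⁻¹ (Ad X a) = a := by
  rw [← Ad_mul_apply, inv_mul_cancel, Ad_one_apply]

theorem Ad_Ad_inv (X : GL (Fin n) K) (a : Mat n K) : Ad X (Ad X⁻¹ a) = a := by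
  rw [← Ad_mul_apply, mul_inv_cancel, Ad_one_apply]

theorem Ad_mul (X : GL (Fin n) K) (a b : Mat n K) : Ad X (a * b) = Ad X a * Ad X b := by
  simp only [Ad_apply, mul_assoc, Units.inv_mul_cancel_left]

theorem trace_Ad (X : GL (Fin n) K) (a : Mat n K) : (Ad X a).trace = a.trace := by
  rw [Ad_apply, Matrix.trace_mul_comm, Units.inv_mul_cancel_left]

theorem Ad_one_mat (X : GL (Fin n) K) : Ad X (1 : Mat n K) = 1 := by
  rw [Ad_apply, mul_one, Units.mul_inv]

theorem slProj_Ad (X : GL (Fin n) K) (a : Mat n K) : slProj n K (Ad X a) = Ad X (slProj n K a) := by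
  rw [slProj_apply, slProj_apply, map_sub, map_smul, trace_Ad, Ad_one_mat]

theorem Ad₂_mul_apply (X Y : GL (Fin n) K) (r : Mat n K ⊗[K] Mat n K) :
    Ad₂ (X * Y) r = Ad₂ X (Ad₂ Y r) := by
  have h : Ad (X * Y) = Ad X ∘ₗ Ad Y := LinearMap.ext (Ad_mul_apply X Y)
  rw [Ad₂, h, TensorProduct.map_comp]
  rfl

theorem Ad₂_one_apply (r : Mat n K ⊗[K] Mat n K) : Ad₂ 1 r = r := by
  have h : Ad (1 : GL (Fin n) K) = LinearMap.id := LinearMap.ext Ad_one_apply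
  rw [Ad₂, h, TensorProduct.map_id]
  rfl

theorem Ad₂_injective (X : GL (Fin n) K) : Function.Injective (Ad₂ X) := by
  intro r r' h
  have := congrArg (Ad₂ X⁻¹) h
  rwa [← Ad₂_mul_apply, ← Ad₂_mul_apply, inv_mul_cancel, Ad₂_one_apply, Ad₂_one_apply] at this

theorem map_slProj_Ad₂ (X : GL (Fin n) K) (r : Mat n K ⊗[K] Mat n K) :
    TensorProduct.map (slProj n K) (slProj n K) (Ad₂ X r) =
      Ad₂ X (TensorProduct.map (slProj n K) (slProj n K) r) := by
  have h : slProj n K ∘ₗ Ad X = Ad X ∘ₗ slProj n K := LinearMap.ext (slProj_Ad X)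
  rw [Ad₂, ← LinearMap.comp_apply, ← LinearMap.comp_apply, ← TensorProduct.map_comp,
    ← TensorProduct.map_comp, h]

theorem isCasimirSplit_Ad₂ (X : GL (Fin n) K) {r : Mat n K ⊗[K] Mat n K}
    (hr : IsCasimirSplit (contract r)) : IsCasimirSplit (contract (Ad₂ X r)) := by
  intro a b
  obtain ⟨a, rfl⟩ : ∃ a', a = Ad X a' := ⟨_, (Ad_Ad_inv X a).symm⟩
  obtain ⟨b, rfl⟩ : ∃ b', b = Ad X b' := ⟨_, (Ad_Ad_inv X b).symm⟩
  simp only [contract_Ad₂, Ad_inv_Ad, slProj_Ad, ← Ad_mul, trace_Ad]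
  exact hr a b

theorem isYangBaxterOp_Ad₂ (X : GL (Fin n) K) {r : Mat n K ⊗[K] Mat n K}
    (hr : IsYangBaxterOp (contract r)) : IsYangBaxterOp (contract (Ad₂ X r)) := by
  intro a b
  obtain ⟨a, rfl⟩ : ∃ a', a = Ad X a' := ⟨_, (Ad_Ad_inv X a).symm⟩
  obtain ⟨b, rfl⟩ : ∃ b', b = Ad X b' := ⟨_, (Ad_Ad_inv X b).symm⟩
  have h : opBracket (contract (Ad₂ X r)) (Ad X a) (Ad X b) = Ad X (opBracket (contract r) a b) := by
    simp only [opBracket, contract_Ad₂, Ad_inv_Ad, ← Ad_mul, map_sub, map_add]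
  rw [h]
  simp only [contract_Ad₂, Ad_inv_Ad, ← Ad_mul, ← map_sub]
  rw [hr]

theorem S_inv : (S n K)⁻¹ = S n K := rfl

theorem S_mul_S : S n K * S n K = 1 := by
  rw [mul_eq_one_iff_eq_inv, S_inv]

theorem Ad_S_apply (a : Mat n K) (i j : Fin n) : Ad (S n K) a i j = a i.rev j.rev := by
  rw [Ad_apply, S_inv]
  have h : ((S n K : GL (Fin n) K) : Mat n K) =
      Matrix.of fun i j => if i = Fin.rev j then 1 else 0 :=
    rfl
  rw [h, Matrix.mul_apply, Finset.sum_eq_single j.rev, Matrix.mul_apply,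
    Finset.sum_eq_single i.rev]
  · simp
  · intro k _ hk
    have : i ≠ k.rev := by rintro rfl; simp at hk
    simp [this]
  · simp
  · intro k _ hk
    simp [hk]
  · simp

end AdAction

/-! ### The quasi-split conjugation -/

section RevStar

variable {F K : Type*} [Field F] [Field K] [Algebra F K] {σ : K ≃ₐ[F] K} {n : ℕ}

/-- The conjugate transpose with respect to the anti-diagonal. -/
noncomputable def revStar (σ : K ≃ₐ[F] K) (a : Mat n K) : Mat n K :=
  Matrix.of fun i j => σ (a j.rev i.rev)

@[simp] theorem revStar_apply (a : Mat n K) (i j : Fin n) :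
    revStar σ a i j = σ (a j.rev i.rev) := rfl

theorem revStar_eq (a : Mat n K) : revStar σ a = Ad (S n K) (starMat σ a) := by
  ext i j
  rw [Ad_S_apply, revStar_apply, starMat_apply]

theorem revStar_revStar (hσ : ∀ z, σ (σ z) = z) (a : Mat n K) : revStar σ (revStar σ a) = a := by
  ext; simp [hσ]

theorem revStar_mul (a b : Mat n K) : revStar σ (a * b) = revStar σ b * revStar σ a := by
  rw [revStar_eq, revStar_eq, revStar_eq, starMat_mul, Ad_mul]

theorem revStar_add (a b : Mat n K) : revStar σ (a + b) = revStar σ a + revStar σ b := by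
  ext; simp

theorem revStar_sub (a b : Mat n K) : revStar σ (a - b) = revStar σ a - revStar σ b := by
  ext; simp

@[simp] theorem revStar_zero : revStar σ (0 : Mat n K) = 0 := by
  ext; simp

theorem revStar_E (i j : Fin n) : revStar σ (E i j : Mat n K) = E j.rev i.rev := by
  ext p q
  rw [revStar_apply, E_apply, E_apply, apply_ite σ, map_one, map_zero]
  congr 1
  rw [Fin.rev_eq_iff, Fin.rev_eq_iff, and_comm]

theorem revStar_upper {a : Mat n K} (ha : a ∈ supportedOn K (· < · : Fin n → Fin n → Prop)) :
    revStar σ a ∈ supportedOn K (· < · : Fin n → Fin n → Prop) := by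
  intro i j hij
  rw [revStar_apply, ha _ _ (by simpa using hij), map_zero]

theorem revStar_lower {a : Mat n K} (ha : a ∈ supportedOn K (· > · : Fin n → Fin n → Prop)) :
    revStar σ a ∈ supportedOn K (· > · : Fin n → Fin n → Prop) := by
  intro i j hij
  rw [revStar_apply, ha _ _ (by simpa using hij), map_zero]

theorem revStar_isDiag {a : Mat n K} (ha : a.IsDiag) : (revStar σ a).IsDiag := by
  intro i j hij
  rw [revStar_apply, ha (by simpa using hij.symm), map_zero]

/-- The tensor conjugate to `r` with respect to the quasi-split form of `sl(n)`. -/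
noncomputable def revConj (σ : K ≃ₐ[F] K) (r : Mat n K ⊗[K] Mat n K) : Mat n K ⊗[K] Mat n K :=
  Ad₂ (S n K) (star₂ σ n r)

/-- Conjugating r amounts to conjugating its operator by `revStar`. Unlike star, `revStar` preserves
upper and lower triangular matrices, so triangularity is inherited. -/
theorem contract_revConj (hσ : ∀ z, σ (σ z) = z) (r : Mat n K ⊗[K] Mat n K) (a : Mat n K) :
    contract (revConj σ r) (revStar σ a) = revStar σ (contract r a) := by
  rw [revConj, contract_Ad₂, contract_star₂ hσ, revStar_eq, Ad_inv_Ad, starMat_starMat σ hσ,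
    revStar_eq]

theorem contract_revConj_pow (hσ : ∀ z, σ (σ z) = z) (r : Mat n K ⊗[K] Mat n K) (m : ℕ)
    (a : Mat n K) :
    (contract (revConj σ r) ^ m) (revStar σ a) = revStar σ ((contract r ^ m) a) := by
  induction m with
  | zero => rfl
  | succ m ih =>
    rw [pow_succ', pow_succ', Module.End.mul_apply, Module.End.mul_apply, ih, contract_revConj hσ]

theorem one_sub_contract_revConj_pow (hσ : ∀ z, σ (σ z) = z) (r : Mat n K ⊗[K] Mat n K) (m : ℕ)
    (a : Mat n K) :
    ((1 - contract (revConj σ r)) ^ m : Module.End K (Mat n K)) (revStar σ a) =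
      revStar σ (((1 - contract r) ^ m : Module.End K (Mat n K)) a) := by
  induction m with
  | zero => rfl
  | succ m ih =>
    rw [pow_succ', pow_succ', Module.End.mul_apply, Module.End.mul_apply, ih, LinearMap.sub_apply,
      LinearMap.sub_apply, contract_revConj hσ, revStar_sub]
    rfl

theorem exists_eq_revStar (hσ : ∀ z, σ (σ z) = z) (a : Mat n K) : ∃ b, a = revStar σ b :=
  ⟨_, (revStar_revStar hσ a).symm⟩

theorem isTriangularOp_revConj (hσ : ∀ z, σ (σ z) = z) {r : Mat n K ⊗[K] Mat n K}
    (hr : IsTriangularOp (contract r)) : IsTriangularOp (contract (revConj σ r)) where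
  upper a ha := by
    rw [← revStar_revStar hσ a, contract_revConj hσ]
    exact revStar_upper (hr.upper _ (revStar_upper ha))
  lower a ha := by
    rw [← revStar_revStar hσ a, contract_revConj hσ]
    exact revStar_lower (hr.lower _ (revStar_lower ha))
  diag a ha := by
    rw [← revStar_revStar hσ a, contract_revConj hσ]
    exact revStar_isDiag (hr.diag _ (revStar_isDiag ha))
  nilpotent := by
    obtain ⟨N, hN⟩ := hr.nilpotent
    refine ⟨N, fun a ha => ?_⟩
    rw [← revStar_revStar hσ a, contract_revConj_pow hσ, hN _ (revStar_lower ha), revStar_zero]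
  unipotent := by
    obtain ⟨N, hN⟩ := hr.unipotent
    refine ⟨N, fun a ha => ?_⟩
    rw [← revStar_revStar hσ a, one_sub_contract_revConj_pow hσ, hN _ (revStar_upper ha),
      revStar_zero]

theorem isCasimirSplit_revConj (hσ : ∀ z, σ (σ z) = z) {r : Mat n K ⊗[K] Mat n K}
    (hr : IsCasimirSplit (contract r)) : IsCasimirSplit (contract (revConj σ r)) :=
  isCasimirSplit_Ad₂ _ (isCasimirSplit_star₂ hσ hr)

theorem isYangBaxterOp_revConj (hσ : ∀ z, σ (σ z) = z) {r : Mat n K ⊗[K] Mat n K}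
    (hr : IsYangBaxterOp (contract r)) : IsYangBaxterOp (contract (revConj σ r)) := by
  intro a b
  obtain ⟨a, rfl⟩ := exists_eq_revStar hσ a
  obtain ⟨b, rfl⟩ := exists_eq_revStar hσ b
  -- `revStar` reverses products, so each commutator changes sign; both sides of Yang–Baxter change
  -- alike.
  have h : opBracket (contract (revConj σ r)) (revStar σ a) (revStar σ b) =
      revStar σ (-opBracket (contract r) a b) := by
    simp only [opBracket, contract_revConj hσ, ← revStar_mul, ← revStar_sub, ← revStar_add]
    congr 1
    abel
  rw [h]
  simp only [contract_revConj hσ, ← revStar_mul, ← revStar_sub, map_neg]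
  rw [← hr, neg_sub]

theorem star₂_Ad₂ {X Y : GL (Fin n) K}
    (hXY : (Y : Mat n K) = starMat σ (X : Mat n K)) (r : Mat n K ⊗[K] Mat n K) :
    star₂ σ n (Ad₂ X r) = Ad₂ Y⁻¹ (star₂ σ n r) := by
  have hinv : ((Y⁻¹ : GL (Fin n) K) : Mat n K) =
      starMat σ ((X⁻¹ : GL (Fin n) K) : Mat n K) := by
    rw [← mul_one ((Y⁻¹ : GL (Fin n) K) : Mat n K), ← starMat_one σ, ← Units.inv_mul X,
      starMat_mul, ← hXY, Units.inv_mul_cancel_left]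
  have h1 : ∀ a, starMat σ (Ad X a) = Ad Y⁻¹ (starMat σ a) := by
    intro a
    rw [Ad_apply, Ad_apply, inv_inv, hXY, hinv, starMat_mul, starMat_mul, mul_assoc]
  induction r with
  | zero => simp
  | add r r' hr hr' => simp only [map_add, hr, hr']
  | tmul a b =>
    simp only [Ad₂, TensorProduct.map_tmul, star₂_tmul, h1]

end RevStar

/-! ### Recovering τ from its iterates, and invariance under s -/

section Combinatorics

variable {n : ℕ} {T : AdmissibleTriple n}

theorem powCount_ne_zero_iff {a b : Fin (n - 1)} :
    powCount T a b ≠ 0 ↔ ∃ k, 1 ≤ k ∧ k < n ∧ T.SimplePowEq k a b := by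
  classical
  rw [powCount, Finset.card_ne_zero, Finset.filter_nonempty_iff]
  simp only [Finset.mem_Ico, and_assoc]

theorem powCount_apply_ne_zero {a : Fin (n - 1)} (ha : a ∈ T.Γ₁) : powCount T a (T.τ a) ≠ 0 := by
  rw [powCount_ne_zero_iff]
  have := a.isLt
  refine ⟨1, le_rfl, by omega, fun m hm => ?_, rfl⟩
  obtain rfl : m = 0 := by omega
  exact ha

theorem mem_of_powCount_ne_zero {a b : Fin (n - 1)} (h : powCount T a b ≠ 0) :
    a ∈ T.Γ₁ ∧ b ∈ T.Γ₂ := by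
  obtain ⟨k, hk, -, hm, hb⟩ := powCount_ne_zero_iff.1 h
  refine ⟨hm 0 (by omega), ?_⟩
  obtain ⟨k, rfl⟩ := Nat.exists_eq_add_of_le' hk
  rw [Function.iterate_succ_apply'] at hb
  rw [← hb]
  exact T.bijOn.mapsTo (hm k (by omega))

theorem AdmissibleTriple.not_simplePowEq_self {k : ℕ} (hk : 1 ≤ k) (a : Fin (n - 1)) :
    ¬ T.SimplePowEq k a a := by
  rintro ⟨hm, ha⟩
  obtain ⟨N, hN⟩ := T.exists_bound
  refine lt_irrefl N (hN N a fun m _ => ?_)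
  have hp : Function.IsPeriodicPt T.τ k a := ha
  rw [← hp.iterate_mod_apply]
  exact hm _ (Nat.mod_lt _ (by omega))

/-- `τ` is determined by the relation "`β = τᵏ(α)` for some `k ≥ 1`". -/
theorem apply_eq_iff {a b : Fin (n - 1)} (ha : a ∈ T.Γ₁) :
    T.τ a = b ↔ powCount T a b ≠ 0 ∧ ∀ c, powCount T a c ≠ 0 → powCount T c b = 0 := by
  constructor
  · rintro rfl
    refine ⟨powCount_apply_ne_zero ha, fun c hac => ?_⟩
    -- A root c strictly between a and τ(a) would make τ(a) periodic with its whole orbit in Γ₁,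
    -- against nilpotency.
    by_contra hcb
    obtain ⟨k, hk, -, hm, rfl⟩ := powCount_ne_zero_iff.1 hac
    obtain ⟨l, hl, -, hm', hb⟩ := powCount_ne_zero_iff.1 hcb
    have hall : ∀ m < k + l, T.τ^[m] a ∈ T.Γ₁ := by
      intro m hmkl
      by_cases hmk : m < k
      · exact hm m hmk
      · obtain ⟨m, rfl⟩ := Nat.exists_eq_add_of_le (not_lt.1 hmk)
        have := hm' m (by omega)
        rwa [← Function.iterate_add_apply, add_comm] at this
    refine T.not_simplePowEq_self (k := k + l - 1) (by omega) (T.τ a) ⟨fun m hm => ?_, ?_⟩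
    · rw [← Function.iterate_succ_apply]
      exact hall _ (by omega)
    · rw [← Function.iterate_succ_apply, ← hb, ← Function.iterate_add_apply]
      congr 2
      omega
  · rintro ⟨hab, hc⟩
    obtain ⟨k, hk, hkn, hm, rfl⟩ := powCount_ne_zero_iff.1 hab
    rcases hk.eq_or_lt with rfl | hk
    · rfl
    -- For k > 1 the root τ(a) itself lies between a and b.
    · refine absurd (hc _ (powCount_apply_ne_zero ha)) (powCount_ne_zero_iff.2
        ⟨k - 1, by omega, by omega, fun m hmk => ?_, ?_⟩)
      · rw [← Function.iterate_succ_apply]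
        exact hm _ (by omega)
      · rw [← Function.iterate_succ_apply]
        congr 2
        omega

/-- The triple is invariant under the reversal `s` of the Dynkin diagram. -/
def AdmissibleTriple.IsRevInvariant (T : AdmissibleTriple n) : Prop :=
  T.Γ₁.image Fin.rev = T.Γ₁ ∧ T.Γ₂.image Fin.rev = T.Γ₂ ∧
    ∀ a ∈ T.Γ₁, Fin.rev (T.τ a) = T.τ (Fin.rev a)

theorem image_rev_eq_self {m : ℕ} {s : Finset (Fin m)} (h : ∀ a ∈ s, a.rev ∈ s) :
    s.image Fin.rev = s := by
  ext a
  rw [Finset.mem_image]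
  constructor
  · rintro ⟨b, hb, rfl⟩
    exact h b hb
  · exact fun ha => ⟨a.rev, h a ha, Fin.rev_rev a⟩

theorem isRevInvariant_of_powCount
    (h : ∀ a b, powCount T a b ≠ 0 ↔ powCount T a.rev b.rev ≠ 0) : T.IsRevInvariant := by
  have h1 : ∀ a ∈ T.Γ₁, a.rev ∈ T.Γ₁ := fun a ha =>
    (mem_of_powCount_ne_zero ((h _ _).1 (powCount_apply_ne_zero ha))).1
  refine ⟨image_rev_eq_self h1, image_rev_eq_self fun b hb => ?_, fun a ha => ?_⟩
  · obtain ⟨a, ha, rfl⟩ := T.bijOn.surjOn hb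
    exact (mem_of_powCount_ne_zero ((h _ _).1 (powCount_apply_ne_zero ha))).2
  · refine ((apply_eq_iff (h1 a ha)).2 ⟨(h _ _).1 (powCount_apply_ne_zero ha), fun c hc => ?_⟩).symm
    by_contra hcb
    have hc' : powCount T a c.rev ≠ 0 := by rwa [h, Fin.rev_rev]
    have := ((apply_eq_iff ha).1 rfl).2 _ hc'
    rw [← Fin.rev_rev c, ← Ne, ← h] at hcb
    exact hcb this

theorem AdmissibleTriple.IsRevInvariant.simplePowEq (h : T.IsRevInvariant) {k : ℕ}
    {a b : Fin (n - 1)} (hab : T.SimplePowEq k a b) : T.SimplePowEq k a.rev b.rev := by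
  have h1 : ∀ a ∈ T.Γ₁, a.rev ∈ T.Γ₁ := fun a ha => by
    have := h.1
    rw [← this]
    exact Finset.mem_image_of_mem _ ha
  have key : ∀ m ≤ k, T.τ^[m] a.rev = (T.τ^[m] a).rev := by
    intro m hm
    induction m with
    | zero => rfl
    | succ m ih =>
      rw [Function.iterate_succ_apply', Function.iterate_succ_apply', ih (by omega),
        h.2.2 _ (hab.1 m (by omega))]
  refine ⟨fun m hm => ?_, by rw [key k le_rfl, hab.2]⟩
  rw [key m hm.le]
  exact h1 _ (hab.1 m hm)

theorem AdmissibleTriple.IsRevInvariant.powCount (h : T.IsRevInvariant) (a b : Fin (n - 1)) :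
    LieBialg.powCount T a.rev b.rev = LieBialg.powCount T a b := by
  classical
  rw [LieBialg.powCount, LieBialg.powCount]
  congr 1
  refine Finset.filter_congr fun k _ => ⟨fun hk => ?_, h.simplePowEq⟩
  have := h.simplePowEq hk
  rwa [Fin.rev_rev, Fin.rev_rev] at this

theorem rev_lo (a : Fin (n - 1)) : (lo a).rev = hi a.rev := by
  have := a.isLt
  ext
  simp only [lo, hi, Fin.val_rev]
  omega

theorem rev_hi (a : Fin (n - 1)) : (hi a).rev = lo a.rev := by
  have := a.isLt
  ext
  simp only [lo, hi, Fin.val_rev]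
  omega

end Combinatorics

/-! ### Comparing a Belavin–Drinfeld r-matrix with its conjugate -/

section Reality

variable {F K : Type*} [Field F] [Field K] [Algebra F K]
  {σ : K ≃ₐ[F] K} {n : ℕ} {T : AdmissibleTriple n} {e : RootVectors n K}
  {r₀ : Mat n K ⊗[K] Mat n K}

/-- `revStar` permutes the simple root vectors by s, and σ fixes the integer entries. -/
theorem revConj_bd_simple_apply (hσ : ∀ z, σ (σ z) = z) (h₀ : r₀ ∈ cartan₂ n K)
    (a b : Fin (n - 1)) :
    contract (revConj σ (r₀ + rOne T e)) (E (lo b) (hi b)) (lo a) (hi a) =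
      (if a = b then 1 else 0) + (powCount T a.rev b.rev : K) := by
  have h : (E (lo b) (hi b) : Mat n K) = revStar σ (E (lo b.rev) (hi b.rev)) := by
    rw [revStar_E, rev_hi, rev_lo, Fin.rev_rev]
  rw [h, contract_revConj hσ, revStar_apply, rev_hi, rev_lo, bd_simple_apply h₀, map_add,
    map_natCast, apply_ite σ, map_one, map_zero]
  simp only [Fin.rev_inj]

theorem conj₂_eq_star₂ (h₀ : r₀ ∈ cartan₂ n K) : conj₂ σ n r₀ = star₂ σ n r₀ := by
  refine cartan₂_induction (P := fun r => conj₂ σ n r = star₂ σ n r) h₀ ?_ ?_ ?_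
  · simp
  · intro r s hr hs
    simp only [map_add, hr, hs]
  · intro x hx y hy
    have h : ∀ x ∈ cartan n K, conjMat σ n x = starMat σ x := by
      intro x hx
      ext i j
      change σ (x i j) = σ (x j i)
      rcases eq_or_ne i j with rfl | hij
      · rfl
      · rw [hx.1 hij, hx.1 hij.symm]
    rw [star₂_tmul, ← h x hx, ← h y hy]
    rfl

/-- Condition on the Cartan part of a Belavin-Drinfeld `r`-matrix, in terms of operators. -/
theorem conj₂_eq_iff (hσ : ∀ z, σ (σ z) = z) (h₀ : r₀ ∈ cartan₂ n K) :
    conj₂ σ n r₀ = Ad₂ (S n K) r₀ ↔ ∀ a : Mat n K, a.IsDiag →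
      contract (revConj σ (r₀ + rOne T e)) a = contract (r₀ + rOne T e) a := by
  have h1 : conj₂ σ n r₀ = Ad₂ (S n K) r₀ ↔ revConj σ r₀ = r₀ := by
    rw [conj₂_eq_star₂ h₀, revConj, ← (Ad₂_injective (S n K)).eq_iff, ← Ad₂_mul_apply, S_mul_S,
      Ad₂_one_apply]
  have h2 : ∀ a : Mat n K, a.IsDiag →
      contract (revConj σ (r₀ + rOne T e)) a = contract (revConj σ r₀) a := by
    intro a ha
    obtain ⟨b, rfl⟩ := exists_eq_revStar hσ a
    have hb : b.IsDiag := by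
      rw [← revStar_revStar hσ b]
      exact revStar_isDiag ha
    rw [contract_revConj hσ, contract_revConj hσ, contract_bd_diag hb]
  rw [h1]
  constructor
  · intro h a ha
    rw [h2 a ha, h, contract_bd_diag ha]
  · intro h
    refine contract_injective (LinearMap.ext fun a => ?_)
    let a' : Mat n K := Matrix.diagonal fun i => a i i
    have ha' : a'.IsDiag := Matrix.isDiag_diagonal _
    have e1 : contract r₀ a = contract r₀ a' := contract_cartan₂_congr h₀ (by simp [a'])
    have e2 : contract (revConj σ r₀) a = contract (revConj σ r₀) a' := by
      rw [← revStar_revStar hσ a, ← revStar_revStar hσ a', contract_revConj hσ,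
        contract_revConj hσ]
      congr 1
      exact contract_cartan₂_congr h₀ (by simp [a'])
    rw [e1, e2, ← h2 a' ha', h a' ha', contract_bd_diag ha']

theorem revConj_bd_eq (hσ : ∀ z, σ (σ z) = z) (hBD : IsBelavinDrinfeld T e r₀)
    (hdiag : ∀ a : Mat n K, a.IsDiag →
      contract (revConj σ (r₀ + rOne T e)) a = contract (r₀ + rOne T e) a)
    (hT : T.IsRevInvariant) : revConj σ (r₀ + rOne T e) = r₀ + rOne T e := by
  have hc := isCasimirSplit_bd (T := T) (e := e) hBD.add_flip
  have hyb := isYangBaxterOp_contract hBD.cyb hc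
  have ht := isTriangularOp_bd (T := T) (e := e) hBD.mem_cartan
  have ht' := isTriangularOp_revConj hσ ht
  -- No comparison of the coefficients of non-simple root vectors is needed: Yang–Baxter for both
  -- operators determines them.
  refine contract_injective (eq_of_eq_simple ht ht' hc
    (isCasimirSplit_revConj hσ hc) hyb (isYangBaxterOp_revConj hσ hyb)
    (fun a ha => bd_simple_mem hBD.mem_cartan ha) hdiag fun b => ?_)
  have hmem := bd_simple_mem (T := T) (e := e) hBD.mem_cartan
    (E_mem_supportedOn (K := K) (n := n) (P := fun i j => i.val + 1 = j.val) (i := lo b)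
      (j := hi b) rfl)
  have hmem' : contract (revConj σ (r₀ + rOne T e)) (E (lo b) (hi b)) ∈
      supportedOn K fun i j : Fin n => i.val + 1 = j.val := by
    have h : (E (lo b) (hi b) : Mat n K) = revStar σ (E (lo b.rev) (hi b.rev)) := by
      rw [revStar_E, rev_hi, rev_lo, Fin.rev_rev]
    rw [h, contract_revConj hσ]
    intro i j hij
    rw [revStar_apply, bd_simple_mem (T := T) (e := e) hBD.mem_cartan
      (E_mem_supportedOn (K := K) (n := n) (P := fun i j => i.val + 1 = j.val) rfl), map_zero]
    simp only [Fin.val_rev]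
    omega
  rw [eq_sum_simple hmem, eq_sum_simple hmem']
  refine Finset.sum_congr rfl fun a _ => ?_
  rw [bd_simple_apply hBD.mem_cartan, revConj_bd_simple_apply hσ hBD.mem_cartan, hT.powCount]

theorem isDiag_mul_mul_apply {Z W : Mat n K} (hZ : Z.IsDiag) (hW : W.IsDiag) (a : Mat n K)
    (i j : Fin n) : (Z * a * W : Mat n K) i j = Z i i * a i j * W j j := by
  rw [Matrix.mul_apply, Finset.sum_eq_single j, Matrix.mul_apply, Finset.sum_eq_single i]
  · intro k _ hk
    rw [hZ hk.symm, zero_mul]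
  · simp
  · intro k _ hk
    rw [hW hk, mul_zero]
  · simp

/-- A Belavin-Drinfeld `r`-matrix is gauge equivalent to its conjugate only if its data are
invariant. -/
theorem invariant_of_revConj_eq_Ad₂ [CharZero K] (hσ : ∀ z, σ (σ z) = z) (h₀ : r₀ ∈ cartan₂ n K)
    {Z : GL (Fin n) K} (h : revConj σ (r₀ + rOne T e) = Ad₂ Z (r₀ + rOne T e)) :
    (∀ a : Mat n K, a.IsDiag →
      contract (revConj σ (r₀ + rOne T e)) a = contract (r₀ + rOne T e) a) ∧
      T.IsRevInvariant := by
  have ht := isTriangularOp_bd (T := T) (e := e) h₀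
  have ht' := isTriangularOp_revConj hσ ht
  have hint : ∀ a, contract (revConj σ (r₀ + rOne T e)) (Ad Z a) =
      Ad Z (contract (r₀ + rOne T e) a) := by
    intro a
    rw [h, contract_Ad₂, Ad_inv_Ad]
  have hZ : (Z : Mat n K).IsDiag := isDiag_of_intertwine ht ht' (Units.inv_mul Z) fun a => by
    rw [← Ad_apply, hint, Ad_apply]
  have hW : ((Z⁻¹ : GL (Fin n) K) : Mat n K).IsDiag :=
    isDiag_of_intertwine ht' ht (Units.mul_inv Z) fun a => by
      have h1 := hint (Ad Z⁻¹ a)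
      rw [Ad_Ad_inv] at h1
      have h2 : ∀ a : Mat n K, ((Z⁻¹ : GL (Fin n) K) : Mat n K) * a * (Z : Mat n K) =
          Ad Z⁻¹ a := fun a => by rw [Ad_apply, inv_inv]
      rw [h2, h2, h1, Ad_inv_Ad]
  have hZW : ∀ i, (Z : Mat n K) i i * ((Z⁻¹ : GL (Fin n) K) : Mat n K) i i = 1 := by
    intro i
    have h1 := congrFun (congrFun (Units.mul_inv Z) i) i
    rwa [Matrix.mul_apply, Finset.sum_eq_single i (fun j _ hj => by rw [hZ hj.symm, zero_mul])
      (by simp), Matrix.one_apply_eq] at h1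
  have hAd : ∀ a : Mat n K, a.IsDiag → Ad Z a = a := by
    intro a ha
    ext i j
    rw [Ad_apply, isDiag_mul_mul_apply hZ hW]
    rcases eq_or_ne i j with rfl | hij
    · rw [mul_right_comm, hZW, one_mul]
    · rw [ha hij, mul_zero, zero_mul]
  constructor
  · intro a ha
    conv_lhs => rw [← hAd a ha]
    rw [hint, hAd _ (ht.diag a ha)]
  · refine isRevInvariant_of_powCount fun a b => ?_
    have hE : Ad Z (E (lo b) (hi b)) =
        ((Z : Mat n K) (lo b) (lo b) * ((Z⁻¹ : GL (Fin n) K) : Mat n K) (hi b) (hi b)) •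
          E (lo b) (hi b) := by
      ext i j
      rw [Ad_apply, isDiag_mul_mul_apply hZ hW, Matrix.smul_apply, E_apply, smul_eq_mul]
      split_ifs with hij
      · rw [hij.1, hij.2]; ring
      · simp
    -- Conjugation by a diagonal matrix only multiplies this entry by nonzero factors, so vanishing
    -- is preserved; on the diagonal a = b the factors agree and cancel.
    have h1 := congrFun (congrFun (hint (E (lo b) (hi b))) (lo a)) (hi a)
    rw [hE, map_smul, Matrix.smul_apply, revConj_bd_simple_apply hσ h₀, Ad_apply,
      isDiag_mul_mul_apply hZ hW, bd_simple_apply h₀, smul_eq_mul] at h1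
    have hz := fun i => left_ne_zero_of_mul_eq_one (hZW i)
    have hw := fun i => right_ne_zero_of_mul_eq_one (hZW i)
    rcases eq_or_ne a b with rfl | hab
    · rw [mul_right_comm ((Z : Mat n K) (lo a) (lo a))] at h1
      have h2 := mul_left_cancel₀ (hz (lo a)) (mul_right_cancel₀ (hw (hi a)) h1)
      have h3 : powCount T a.rev a.rev = powCount T a a := by
        exact_mod_cast add_left_cancel h2
      rw [h3]
    · simp only [if_neg hab, zero_add] at h1
      rw [← Nat.cast_ne_zero (R := K), ← Nat.cast_ne_zero (R := K) (n := powCount T a.rev b.rev)]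
      constructor
      · intro h2 h3
        rw [h3, mul_zero] at h1
        exact mul_ne_zero (mul_ne_zero (hz _) h2) (hw _) h1.symm
      · intro h2 h3
        rw [h3, mul_zero, zero_mul] at h1
        exact mul_ne_zero (mul_ne_zero (hz _) (hw _)) h2 h1

end Reality

end LieBialg

/-! ### The proposition -/

theorem mainTheorem10 {F K : Type*} [Field F] [CharZero F] [Field K] [Algebra F K]
    (d : F) (hd : ¬ IsSquare d) (sqrtd : K) (hsqrtd : sqrtd ^ 2 = algebraMap F K d)
    (hK : IntermediateField.adjoin F {sqrtd} = ⊤)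
    (σ : K ≃ₐ[F] K) (hσ : σ sqrtd = -sqrtd) (n : ℕ)
    (T : LieBialg.AdmissibleTriple n) (e : LieBialg.RootVectors n K)
    (r₀ r : LieBialg.Mat n K ⊗[K] LieBialg.Mat n K)
    (hBD : LieBialg.IsBelavinDrinfeld T e r₀)
    (X : GL (Fin n) K)
    (hr : r = LieBialg.Ad₂ X (r₀ + LieBialg.rOne T e)) :
    LieBialg.DefinesLieBialgebra σ r ↔
      (∃ D ∈ LieBialg.centralizer (r₀ + LieBialg.rOne T e),
        LieBialg.starMat σ (X : LieBialg.Mat n K) * (X : LieBialg.Mat n K) =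
          (LieBialg.S n K : LieBialg.Mat n K) * (D : LieBialg.Mat n K)) ∧
      LieBialg.conj₂ σ n r₀ = LieBialg.Ad₂ (LieBialg.S n K) r₀ ∧
      (T.Γ₁.image Fin.rev = T.Γ₁ ∧ T.Γ₂.image Fin.rev = T.Γ₂ ∧
        ∀ a ∈ T.Γ₁, Fin.rev (T.τ a) = T.τ (Fin.rev a)) := by
  open LieBialg in
  have : CharZero K := charZero_of_injective_algebraMap (algebraMap F K).injective
  have hq := isQuadraticConj_of_adjoin hd hsqrtd hK hσ
  have hinv := hq.involutive
  have hc := isCasimirSplit_bd (T := T) (e := e) hBD.add_flip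
  have hyb := isYangBaxterOp_contract hBD.cyb hc
  let Y : GL (Fin n) K :=
    { val := starMat σ (X : Mat n K)
      inv := starMat σ ((X⁻¹ : GL (Fin n) K) : Mat n K)
      val_inv := by rw [← starMat_mul, Units.inv_mul, starMat_one]
      inv_val := by rw [← starMat_mul, Units.mul_inv, starMat_one] }
  have hY : (Y : Mat n K) = starMat σ (X : Mat n K) := rfl
  have h1 : DefinesLieBialgebra σ r ↔
      revConj σ (r₀ + rOne T e) = Ad₂ (S n K * (Y * X)) (r₀ + rOne T e) := by
    rw [hr, definesLieBialgebra_iff hq (by rw [map_slProj_Ad₂, map_slProj_bd hBD.mem_cartan])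
      (isCasimirSplit_Ad₂ X hc) (isYangBaxterOp_Ad₂ X hyb), star₂_Ad₂ hY, revConj,
      Ad₂_mul_apply (S n K), (Ad₂_injective _).eq_iff, ← (Ad₂_injective Y).eq_iff,
      ← Ad₂_mul_apply, mul_inv_cancel, Ad₂_one_apply, Ad₂_mul_apply]
  -- Since S² = 1, the only possible D is S X* X.
  have h2 : (∃ D ∈ centralizer (r₀ + rOne T e), starMat σ (X : Mat n K) * (X : Mat n K) =
      (S n K : Mat n K) * (D : Mat n K)) ↔
      Ad₂ (S n K * (Y * X)) (r₀ + rOne T e) = r₀ + rOne T e := by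
    constructor
    · rintro ⟨D, hD, hXD⟩
      have : Y * X = S n K * D := Units.ext hXD
      rw [this, ← mul_assoc, S_mul_S, one_mul]
      exact hD
    · intro h
      refine ⟨S n K * (Y * X), h, ?_⟩
      rw [← Units.val_mul, ← mul_assoc, S_mul_S, one_mul]
      rfl
  rw [h1, h2, conj₂_eq_iff (T := T) (e := e) hinv hBD.mem_cartan]
  constructor
  · intro h
    obtain ⟨h3, h4⟩ := invariant_of_revConj_eq_Ad₂ hinv hBD.mem_cartan h
    exact ⟨h.symm.trans (revConj_bd_eq hinv hBD h3 h4), h3, h4⟩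
  · rintro ⟨h, h3, h4⟩
    rw [h, revConj_bd_eq hinv hBD h3 h4]
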